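/- Setting. For $I\subseteq\mathbb R^D$ and $r>0$, an $r$-similarity of $I$ is a subset $J\subseteq I$ with $J=S(I)$ for some similarity $S$ of $\mathbb R^D$ with factor $r$. Such sets $J_1,\dots,J_t$ are $\tau$-separated if $d(J_i,J_j)\ge \tau\, r\,\mathrm{diam}(I)$ for $i\ne j$; if $t$ such sets exist, $I$ has the $(t,r,\tau)$-separation property. Fix a compact set $I_0\subseteq\mathbb R^D$ of diameter $1$ with non-empty interior, $0<\tau<1$, and for each integer $t\ge 2$ a number $\rho_t\in(0,1/2]$ such that $I_0$ has the $(t,r,\tau)$-separation property for all $0<r\le\rho_t$. Let $\mathcal S_t=\{x\in\mathbb R^t: x_i>0,\ \sum_i x_i=1\}$ and let $\Omega_0=\bigcup_{t\ge2}(0,\rho_t]\times\mathcal S_t$ (disjoint union). Let $\pi$ be a Borel probability measure on $\Omega_0$ and $\mathbb P=\pi^{\otimes\mathbb N}$ on $\Omega=\Omega_0^{\mathbb N}$. A sample $\omega\in\Omega$ is thus an iid sequence $(T_n,r_n,p_n)_{n\ge1}$ with law $\pi$, where $T_n$ is an integer $\ge2$, $0<r_n\le\rho_{T_n}$ and $p_n=(p_n^{(1)},\dots,p_n^{(T_n)})\in\mathcal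 S_{T_n}$. Put $X_n=-\log\max_j p_n^{(j)}$, $Y_n=-\log\min_j p_n^{(j)}$, $Z_n=-\log r_n$. Given $\omega$, Moran sets are chosen as follows: $I_0$ is the Moran set of step $0$, and inside each Moran set $I$ of step $n$ one chooses $T_{n+1}$ sets $I^{(1)},\dots,I^{(T_{n+1})}$ (its children, the Moran sets of step $n+1$) that are $r_{n+1}$-similarities of $I$ and are $\tau$-separated; the choice is otherwise arbitrary. The Moran measure $\mu_\omega$ is the Borel probability measure on $\mathbb R^D$ with $\mu_\omega(I_0)=1$ and $\mu_\omega(I^{(j)})=\mu_\omega(I)\,p_{n+1}^{(j)}$ for every Moran set $I$ of step $n$ and each of its children $I^{(j)}$. A dimension function is a map $\Phi:(0,1)\to[0,\infty)$ such that $x^{1+\Phi(x)}$ decreases to $0$ as $x$ decreases to $0$. It is large if there are a function $A$ and $\delta>0$ with $\Phi(x)\ge A(x)\,\log|\log x|/|\log x|$ for all $0<x<\delta$, $x<1$, and $A(x)\to\infty$ as $x\to0^+$. The upper $\Phi$-dimension $\overline{\dim}_\Phi\mu$ of a Borel probability measure $\mu$ is the infimum of those $d\in\mathbb R$ for which there are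 $C_1\in(0,1)$ and $C_2>0$ such that $$\frac{\mu(B(x,R))}{\mu(B(x,r))}\le C_2\Big(\frac Rr\Big)^d\quad\text{for all } 0<r<R^{1+\Phi(R)}\le R\le C_1 \text{ and all } x\in\mathrm{supp}\,\mu,$$ and the lower $\Phi$-dimension $\underline{\dim}_\Phi\mu$ is the supremum of those $d\in\mathbb R$ for which there are such $C_1,C_2$ with the inequality $\ge$ in place of $\le$. Here $B(x,R)$ is the open ball. Theorem. Assume that there is $A>0$ with $\mathbb E(e^{\lambda Z_1})<\infty$ for all $|\lambda|\le A$. Then there is a measurable set $\Gamma\subseteq\Omega$ with $\mathbb P(\Gamma)=1$ such that: (i) if there is $A>0$ with $\mathbb E(e^{\lambda X_1})<\infty$ for all $|\lambda|\le A$, then $\underline{\dim}_\Phi\mu_\omega=\mathbb E(X_1)/\mathbb E(Z_1)$ for all large dimension functions $\Phi$, all $\omega\in\Gamma$ and all choices of the Moran sets; (ii) if there is $A>0$ with $\mathbb E(e^{\lambda Y_1})<\infty$ for all $|\lambda|\le A$, then $\overline{\dim}_\Phi\mu_\omega=\mathbb E(Y_1)/\mathbb E(Z_1)$ for all large dimension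 functions $\Phi$, all $\omega\in\Gamma$ and all choices of the Moran sets. -/

import Mathlib

open MeasureTheory Filter Topology Set

noncomputable section

namespace Moran

/-! ### Dimension functions and the `Φ`-dimensions of a measure -/

/-- A dimension function: a map `Φ : (0,1) → [0,∞)` such that `x ^ (1 + Φ x)` decreases to `0` as
`x` decreases to `0`. Values of `Φ` outside `(0,1)` are irrelevant. -/
structure IsDimensionFunction (Φ : ℝ → ℝ) : Prop where
  nonneg : ∀ x ∈ Ioo (0 : ℝ) 1, 0 ≤ Φ x
  monotoneOn : MonotoneOn (fun x : ℝ => x ^ (1 + Φ x)) (Ioo 0 1)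
  tendsto : Tendsto (fun x : ℝ => x ^ (1 + Φ x)) (𝓝[>] 0) (𝓝 0)

/-- `f ≫ g` near `0`, for functions on `(0,1)`. -/
def MuchLarger (f g : ℝ → ℝ) : Prop :=
  ∃ (A : ℝ → ℝ) (δ : ℝ), 0 < δ ∧ (∀ x ∈ Ioo (0 : ℝ) 1, x < δ → A x * g x ≤ f x) ∧
    Tendsto A (𝓝[>] 0) atTop

/-- A dimension function is large if `Φ(x) ≫ log |log x| / |log x|`. -/
def IsLarge (Φ : ℝ → ℝ) : Prop :=
  IsDimensionFunction Φ ∧ MuchLarger Φ (fun x => Real.log |Real.log x| / |Real.log x|)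

section Dimensions

variable {X : Type*} [MetricSpace X] [MeasurableSpace X]

/-- The upper `Φ`-dimension of `μ`, in `[-∞, ∞]`. The bound `C₁ < 1` only says that `R` stays in
the domain of `Φ`. -/
def upperDim (Φ : ℝ → ℝ) (μ : Measure X) : EReal :=
  sInf ((fun d : ℝ => (d : EReal)) '' {d : ℝ | ∃ C₁ C₂ : ℝ, 0 < C₁ ∧ C₁ < 1 ∧ 0 < C₂ ∧
    ∀ r R : ℝ, 0 < r → r < R ^ (1 + Φ R) → R ^ (1 + Φ R) ≤ R → R ≤ C₁ →
      ∀ x ∈ μ.support, μ.real (Metric.ball x R) / μ.real (Metric.ball x r) ≤ C₂ * (R / r) ^ d})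

/-- The lower `Φ`-dimension of `μ`, in `[-∞, ∞]`. -/
def lowerDim (Φ : ℝ → ℝ) (μ : Measure X) : EReal :=
  sSup ((fun d : ℝ => (d : EReal)) '' {d : ℝ | ∃ C₁ C₂ : ℝ, 0 < C₁ ∧ C₁ < 1 ∧ 0 < C₂ ∧
    ∀ r R : ℝ, 0 < r → r < R ^ (1 + Φ R) → R ^ (1 + Φ R) ≤ R → R ≤ C₁ →
      ∀ x ∈ μ.support, C₂ * (R / r) ^ d ≤ μ.real (Metric.ball x R) / μ.real (Metric.ball x r)})

end Dimensions

/-! ### Separated families of similar copies -/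

section Geometry

variable {D : ℕ}

/-- `S` is a similarity of `ℝ^D` with factor `r`. -/
def IsSimilarity (r : ℝ) (S : EuclideanSpace ℝ (Fin D) → EuclideanSpace ℝ (Fin D)) : Prop :=
  ∀ x y, dist (S x) (S y) = r * dist x y

/-- `J` is an `r`-similarity of `I`: a subset of `I` that is the image of `I` under a similarity
with factor `r` (so that `diam J = r * diam I`). -/
def IsSimilarCopy (r : ℝ) (I J : Set (EuclideanSpace ℝ (Fin D))) : Prop :=
  J ⊆ I ∧ ∃ S, IsSimilarity r S ∧ J = S '' I

/-- `J 0, …, J (t-1)` are `r`-similarities of `I` that are `τ`-separated: distinct ones are at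
distance at least `τ * r * diam I`. -/
structure IsSeparatedFamily (τ r : ℝ) (I : Set (EuclideanSpace ℝ (Fin D))) {t : ℕ}
    (J : Fin t → Set (EuclideanSpace ℝ (Fin D))) : Prop where
  copy : ∀ j, IsSimilarCopy r I (J j)
  separated : ∀ i j, i ≠ j → ∀ x ∈ J i, ∀ y ∈ J j, τ * r * Metric.diam I ≤ dist x y

/-- The `(t, r, τ)`-separation property of `I`. -/
def HasSeparation (I : Set (EuclideanSpace ℝ (Fin D))) (t : ℕ) (r τ : ℝ) : Prop :=
  ∃ J : Fin t → Set (EuclideanSpace ℝ (Fin D)), IsSeparatedFamily τ r I J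

end Geometry

/-- The fixed data: a compact set `I₀ ⊆ ℝ^D` of diameter `1` with non-empty interior, a number
`0 < τ < 1`, and for each `t ≥ 2` a number `ρ t ∈ (0, 1/2]` such that `I₀` has the
`(t, r, τ)`-separation property for all `0 < r ≤ ρ t`. -/
structure Setting (D : ℕ) where
  I₀ : Set (EuclideanSpace ℝ (Fin D))
  isCompact : IsCompact I₀
  diam_eq : Metric.diam I₀ = 1
  interior_nonempty : (interior I₀).Nonempty
  τ : ℝ
  τ_pos : 0 < τ
  τ_lt_one : τ < 1
  ρ : ℕ → ℝ
  ρ_pos : ∀ t, 2 ≤ t → 0 < ρ t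
  ρ_le : ∀ t, 2 ≤ t → ρ t ≤ 1 / 2
  separation : ∀ t, 2 ≤ t → ∀ r, 0 < r → r ≤ ρ t → HasSeparation I₀ t r τ

variable {D : ℕ}

/-- `Ω₀`, the disjoint union over `t ≥ 2` of `(0, ρ t] × 𝒮_t`, where `𝒮_t` is the simplex of
strictly positive probability vectors of length `t`; it carries the Borel `σ`-algebra of the
disjoint union. -/
abbrev Param (𝒮 : Setting D) : Type :=
  (t : {t : ℕ // 2 ≤ t}) × {x : ℝ × (Fin (t : ℕ) → ℝ) //
    (0 < x.1 ∧ x.1 ≤ 𝒮.ρ t) ∧ (∀ i, 0 < x.2 i) ∧ ∑ i, x.2 i = 1}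

namespace Param

variable {𝒮 : Setting D}

/-- The number of children. -/
def T (a : Param 𝒮) : ℕ := a.1

/-- The ratio of child to parent diameter. -/
def r (a : Param 𝒮) : ℝ := a.2.1.1

/-- The probability vector. -/
def p (a : Param 𝒮) : Fin a.T → ℝ := a.2.1.2

/-- `X = - log max_j p^(j)`. -/
def X (a : Param 𝒮) : ℝ := - Real.log (⨆ j, a.p j)

/-- `Y = - log min_j p^(j)`. -/
def Y (a : Param 𝒮) : ℝ := - Real.log (⨅ j, a.p j)

/-- `Z = - log r`. -/
def Z (a : Param 𝒮) : ℝ := - Real.log a.r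

lemma r_pos (a : Param 𝒮) : 0 < a.r := a.2.2.1.1

lemma r_le (a : Param 𝒮) : a.r ≤ 1 / 2 := a.2.2.1.2.trans (𝒮.ρ_le _ a.1.2)

lemma p_pos (a : Param 𝒮) (j : Fin a.T) : 0 < a.p j := a.2.2.2.1 j

lemma sum_p (a : Param 𝒮) : ∑ j, a.p j = 1 := a.2.2.2.2

/-- The probability measure on the labels `{0, …, T-1}` of the children with weights `p`. -/
def labelMeasure (a : Param 𝒮) : Measure (Fin a.T) :=
  ∑ j, ENNReal.ofReal (a.p j) • Measure.dirac j

lemma labelMeasure_singleton (a : Param 𝒮) (j : Fin a.T) :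
    a.labelMeasure {j} = ENNReal.ofReal (a.p j) := by
  classical
  simp only [labelMeasure, Measure.coe_finsetSum, Finset.sum_apply, Measure.smul_apply,
    smul_eq_mul]
  rw [Finset.sum_eq_single j]
  · simp
  · intro b _ hb
    simp [hb]
  · simp

instance (a : Param 𝒮) : IsProbabilityMeasure a.labelMeasure := ⟨by
  simp only [labelMeasure, Measure.coe_finsetSum, Finset.sum_apply, Measure.smul_apply,
    smul_eq_mul, measure_univ, mul_one]
  rw [← ENNReal.ofReal_sum_of_nonneg fun j _ => (a.p_pos j).le, a.sum_p, ENNReal.ofReal_one]⟩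

end Param

/-- `Ω = Ω₀^ℕ`: the term `ω n` holds `(T_{n+1}, r_{n+1}, p_{n+1})`. -/
abbrev Sample (𝒮 : Setting D) : Type := ℕ → Param 𝒮

/-- The law `ℙ` on `Ω` of an iid sequence with common law `π`. -/
def sampleLaw {𝒮 : Setting D} (π : Measure (Param 𝒮)) : Measure (Sample 𝒮) :=
  Measure.infinitePi fun _ : ℕ => π

/-- There is `A > 0` such that `𝔼 (exp (s * W)) < ∞` for all `|s| ≤ A`. -/
def HasExpMoments {Ω : Type*} [MeasurableSpace Ω] (P : Measure Ω) (W : Ω → ℝ) : Prop :=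
  ∃ A : ℝ, 0 < A ∧ ∀ s : ℝ, |s| ≤ A → Integrable (fun ω => Real.exp (s * W ω)) P

/-! ### Moran sets and the Moran measure -/

variable {𝒮 : Setting D}

/-- Addresses of the Moran sets of step `n`. -/
abbrev Word (ω : Sample 𝒮) (n : ℕ) : Type := (i : Fin n) → Fin (ω i).T

/-- The address of the `j`-th child of the Moran set with address `v`. -/
def Word.child {ω : Sample 𝒮} {n : ℕ} (v : Word ω n) (j : Fin (ω n).T) : Word ω (n + 1) :=
  Fin.snoc (α := fun i : Fin (n + 1) => Fin (ω i).T) v j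

/-- Infinite addresses. -/
abbrev Code (ω : Sample 𝒮) : Type := (n : ℕ) → Fin (ω n).T

/-- The first `n` letters of an infinite address. -/
def Code.trunc {ω : Sample 𝒮} (x : Code ω) (n : ℕ) : Word ω n := fun i => x i

/-- A choice of all the Moran sets for the sample `ω`: `cell n v` is the Moran set of step `n` with
address `v`, and the children of a Moran set `I` of step `n` are `T_{n+1}` arbitrarily chosen
`r_{n+1}`-similarities of `I` that are `τ`-separated. -/
structure Construction (ω : Sample 𝒮) where
  cell : (n : ℕ) → Word ω n → Set (EuclideanSpace ℝ (Fin D))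
  cell_zero : ∀ v : Word ω 0, cell 0 v = 𝒮.I₀
  children : ∀ (n : ℕ) (v : Word ω n),
    IsSeparatedFamily 𝒮.τ (ω n).r (cell n v) fun j => cell (n + 1) (v.child j)

lemma Code.trunc_succ {ω : Sample 𝒮} (x : Code ω) (n : ℕ) :
    x.trunc (n + 1) = (x.trunc n).child (x n) := by
  funext i
  refine Fin.lastCases ?_ (fun i => ?_) i
  · simp [Code.trunc, Word.child]
  · simp [Code.trunc, Word.child]

lemma Word.exists_child {ω : Sample 𝒮} {n : ℕ} (w : Word ω (n + 1)) :
    ∃ (v : Word ω n) (j : Fin (ω n).T), w = v.child j :=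
  ⟨Fin.init (α := fun i : Fin (n + 1) => Fin (ω i).T) w, w (Fin.last n),
    (Fin.snoc_init_self (α := fun i : Fin (n + 1) => Fin (ω i).T) w).symm⟩

namespace Construction

variable {ω : Sample 𝒮} (C : Construction ω)

lemma cell_child_subset {n : ℕ} (v : Word ω n) (j : Fin (ω n).T) :
    C.cell (n + 1) (v.child j) ⊆ C.cell n v := ((C.children n v).copy j).1

lemma isCompact_cell : ∀ (n : ℕ) (v : Word ω n), IsCompact (C.cell n v)
  | 0, v => by rw [C.cell_zero]; exact 𝒮.isCompact
  | n + 1, w => by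
    obtain ⟨v, j, rfl⟩ := w.exists_child
    obtain ⟨-, S, hS, h⟩ := (C.children n v).copy j
    have hc : Continuous S := by
      have : LipschitzWith (Real.toNNReal (ω n).r) S :=
        LipschitzWith.of_dist_le' fun x y => (hS x y).le
      exact this.continuous
    rw [h]
    exact (isCompact_cell n v).image hc

lemma cell_nonempty : ∀ (n : ℕ) (v : Word ω n), (C.cell n v).Nonempty
  | 0, v => by rw [C.cell_zero]; exact 𝒮.interior_nonempty.mono interior_subset
  | n + 1, w => by
    obtain ⟨v, j, rfl⟩ := w.exists_child
    obtain ⟨-, S, -, h⟩ := (C.children n v).copy j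
    rw [h]
    exact (cell_nonempty n v).image S

lemma diam_child {n : ℕ} (v : Word ω n) (j : Fin (ω n).T) :
    Metric.diam (C.cell (n + 1) (v.child j)) = (ω n).r * Metric.diam (C.cell n v) := by
  obtain ⟨-, S, hS, h⟩ := (C.children n v).copy j
  have hr := (ω n).r_pos
  rw [h]
  apply le_antisymm
  · refine Metric.diam_le_of_forall_dist_le (by positivity) ?_
    rintro _ ⟨x, hx, rfl⟩ _ ⟨y, hy, rfl⟩
    rw [hS]
    gcongr
    exact Metric.dist_le_diam_of_mem (C.isCompact_cell n v).isBounded hx hy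
  · rw [mul_comm, ← le_div_iff₀ hr]
    refine Metric.diam_le_of_forall_dist_le (by positivity) fun x hx y hy => ?_
    rw [le_div_iff₀ hr, mul_comm, ← hS]
    refine Metric.dist_le_diam_of_mem ?_ (mem_image_of_mem S hx) (mem_image_of_mem S hy)
    rw [← h]
    exact (C.isCompact_cell _ _).isBounded

/-- The Moran sets of step `n` have diameter `r_1 ⋯ r_n`. -/
lemma diam_cell : ∀ (n : ℕ) (v : Word ω n),
    Metric.diam (C.cell n v) = ∏ i ∈ Finset.range n, (ω i).r
  | 0, v => by rw [C.cell_zero, 𝒮.diam_eq]; simp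
  | n + 1, w => by
    obtain ⟨v, j, rfl⟩ := w.exists_child
    rw [C.diam_child, diam_cell n v, Finset.prod_range_succ, mul_comm]

lemma disjoint_cell : ∀ (n : ℕ) (v w : Word ω n), v ≠ w → Disjoint (C.cell n v) (C.cell n w)
  | 0, v, w => fun h => absurd (Subsingleton.elim v w) h
  | n + 1, v', w' => fun hne => by
    obtain ⟨v, i, rfl⟩ := v'.exists_child
    obtain ⟨w, j, rfl⟩ := w'.exists_child
    by_cases hvw : v = w
    · subst hvw
      have hij : i ≠ j := fun h => hne (by rw [h])
      rw [Set.disjoint_left]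
      intro x hx hy
      have h := (C.children n v).separated i j hij x hx x hy
      rw [dist_self, C.diam_cell] at h
      have : 0 < 𝒮.τ * (ω n).r * ∏ i ∈ Finset.range n, (ω i).r :=
        mul_pos (mul_pos 𝒮.τ_pos (ω n).r_pos) (Finset.prod_pos fun i _ => (ω i).r_pos)
      linarith
    · exact (disjoint_cell n v w hvw).mono (C.cell_child_subset v i) (C.cell_child_subset w j)

lemma nonempty_iInter_cell (x : Code ω) : (⋂ n, C.cell n (x.trunc n)).Nonempty := by
  refine IsCompact.nonempty_iInter_of_sequence_nonempty_isCompact_isClosed _ (fun n => ?_)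
    (fun n => C.cell_nonempty n _) (C.isCompact_cell 0 _)
    (fun n => (C.isCompact_cell n _).isClosed)
  rw [x.trunc_succ]
  exact C.cell_child_subset _ _

/-- The point of the Moran set with a given infinite address: the unique point that lies in all the
Moran sets `I_n(x)` along that address. -/
def point (x : Code ω) : EuclideanSpace ℝ (Fin D) := (C.nonempty_iInter_cell x).some

lemma point_mem (x : Code ω) (n : ℕ) : C.point x ∈ C.cell n (x.trunc n) :=
  mem_iInter.1 (C.nonempty_iInter_cell x).some_mem n

lemma measurable_point : Measurable C.point := by
  refine measurable_of_tendsto_metrizable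
    (f := fun n (x : Code ω) => (C.cell_nonempty n (x.trunc n)).some) (fun n => ?_) ?_
  · have h1 : Measurable fun x : Code ω => x.trunc n :=
      measurable_pi_lambda _ fun i => measurable_pi_apply (i : ℕ)
    have h2 : Measurable fun v : Word ω n => (C.cell_nonempty n v).some := measurable_of_finite _
    exact h2.comp h1
  · rw [tendsto_pi_nhds]
    intro x
    rw [tendsto_iff_dist_tendsto_zero]
    refine squeeze_zero (fun _ => dist_nonneg) (fun n => ?_)
      (tendsto_pow_atTop_nhds_zero_of_lt_one (r := (1 / 2 : ℝ)) (by norm_num) (by norm_num))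
    refine (Metric.dist_le_diam_of_mem (C.isCompact_cell n (x.trunc n)).isBounded
      (C.cell_nonempty n (x.trunc n)).some_mem (C.point_mem x n)).trans ?_
    rw [C.diam_cell]
    calc ∏ i ∈ Finset.range n, (ω i).r ≤ ∏ _i ∈ Finset.range n, (1 / 2 : ℝ) :=
          Finset.prod_le_prod (fun i _ => (ω i).r_pos.le) fun i _ => (ω i).r_le
      _ = (1 / 2) ^ n := by simp

/-- The Moran measure `μ_ω`: the image of the product of the weights `p_1, p_2, …` under the
coding map. By `measure_cell` below it satisfies `μ (I^(j)) = μ I * p_{n+1}^(j)` for the children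
`I^(j)` of a Moran set `I` of step `n`. -/
def measure : Measure (EuclideanSpace ℝ (Fin D)) :=
  (Measure.infinitePi fun n => (ω n).labelMeasure).map C.point

instance : IsProbabilityMeasure C.measure :=
  Measure.isProbabilityMeasure_map C.measurable_point.aemeasurable

theorem measure_cell (n : ℕ) (v : Word ω n) :
    C.measure (C.cell n v) = ∏ i : Fin n, ENNReal.ofReal ((ω i).p (v i)) := by
  classical
  have hpre : C.point ⁻¹' C.cell n v = {x : Code ω | x.trunc n = v} := by
    ext x
    constructor
    · intro hx
      by_contra hne
      exact Set.disjoint_left.1 (C.disjoint_cell n _ _ hne) (C.point_mem x n) hx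
    · rintro rfl
      exact C.point_mem x n
  have hset : {x : Code ω | x.trunc n = v} = Set.pi (Finset.range n : Set ℕ)
      (fun i => {a : Fin (ω i).T | ∀ h : i < n, a = v ⟨i, h⟩}) := by
    ext x
    simp only [Set.mem_ofPred_eq, Set.mem_pi, Finset.coe_range, mem_Iio, funext_iff, Code.trunc]
    exact ⟨fun h i _ hi => h ⟨i, hi⟩, fun h i => h i i.2 i.2⟩
  rw [measure, Measure.map_apply C.measurable_point (C.isCompact_cell n v).measurableSet, hpre,
    hset, Measure.infinitePi_pi _ fun i _ => MeasurableSet.of_discrete, Finset.prod_range]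
  refine Finset.prod_congr rfl fun i _ => ?_
  have hi : {a : Fin (ω i).T | ∀ h : (i : ℕ) < n, a = v ⟨i, h⟩} = {v i} := by
    ext a
    simp
  rw [hi, Param.labelMeasure_singleton]

end Construction

/-! ### Moran sets exist for every sample -/

lemma IsSimilarity.surjective {r : ℝ} (hr : 0 < r)
    {S : EuclideanSpace ℝ (Fin D) → EuclideanSpace ℝ (Fin D)} (hS : IsSimilarity r S) :
    Function.Surjective S := by
  have hiso : Isometry fun x => r⁻¹ • S x := Isometry.of_dist_eq fun x y => by
    rw [dist_smul₀, hS, Real.norm_of_nonneg (inv_nonneg.2 hr.le), inv_mul_cancel_left₀ hr.ne']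
  have hsurj : Function.Surjective hiso.affineIsometryOfStrictConvexSpace :=
    (hiso.affineIsometryOfStrictConvexSpace.toAffineIsometryEquiv rfl).surjective
  intro y
  obtain ⟨x, hx⟩ := hsurj (r⁻¹ • y)
  exact ⟨x, smul_right_injective _ (inv_ne_zero hr.ne') hx⟩

/-- Every similar copy of a set inherits its separation property. -/
lemma HasSeparation.image {I : Set (EuclideanSpace ℝ (Fin D))} {t : ℕ} {r τ c : ℝ}
    (h : HasSeparation I t r τ) (hτ : 0 ≤ τ) (hr : 0 ≤ r) (hI : IsCompact I) (hc : 0 < c)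
    {S : EuclideanSpace ℝ (Fin D) → EuclideanSpace ℝ (Fin D)} (hS : IsSimilarity c S) :
    HasSeparation (S '' I) t r τ := by
  obtain ⟨J, hJ⟩ := h
  have hinv : ∀ y, S (Function.surjInv (hS.surjective hc) y) = y :=
    Function.surjInv_eq (hS.surjective hc)
  refine ⟨fun j => S '' J j, fun j => ?_, fun i j hij => ?_⟩
  · obtain ⟨hsub, G, hG, hGJ⟩ := hJ.copy j
    refine ⟨image_mono hsub, fun y => S (G (Function.surjInv (hS.surjective hc) y)),
      fun x y => ?_, ?_⟩
    · have h1 := hS (Function.surjInv (hS.surjective hc) x) (Function.surjInv (hS.surjective hc) y)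
      rw [hinv, hinv] at h1
      rw [hS, hG, h1]
      ring
    · have hinj : Function.Injective S := fun x y hxy => by
        have := hS x y
        rw [hxy, dist_self] at this
        exact dist_eq_zero.1 ((mul_eq_zero.1 this.symm).resolve_left hc.ne')
      rw [hGJ, image_image, image_image]
      refine image_congr fun x _ => ?_
      rw [hinj (hinv (S x))]
  · rintro _ ⟨x, hx, rfl⟩ _ ⟨y, hy, rfl⟩
    have hd : Metric.diam (S '' I) ≤ c * Metric.diam I := by
      refine Metric.diam_le_of_forall_dist_le (by positivity) ?_
      rintro _ ⟨x, hx, rfl⟩ _ ⟨y, hy, rfl⟩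
      rw [hS]
      gcongr
      exact Metric.dist_le_diam_of_mem hI.isBounded hx hy
    rw [hS]
    calc τ * r * Metric.diam (S '' I) ≤ τ * r * (c * Metric.diam I) := by gcongr
      _ = c * (τ * r * Metric.diam I) := by ring
      _ ≤ c * dist x y := by
        gcongr
        exact hJ.separated i j hij x hx y hy

/-- Moran sets can be chosen for every sample. -/
theorem Construction.nonempty (ω : Sample 𝒮) : Nonempty (Construction ω) := by
  let Q : Set (EuclideanSpace ℝ (Fin D)) → Prop := fun I =>
    ∃ c S, 0 < c ∧ IsSimilarity c S ∧ I = S '' 𝒮.I₀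
  have step : ∀ (n : ℕ) (I : {I : Set (EuclideanSpace ℝ (Fin D)) // Q I}),
      ∃ J : Fin (ω n).T → {I : Set (EuclideanSpace ℝ (Fin D)) // Q I},
        IsSeparatedFamily 𝒮.τ (ω n).r I.1 fun j => (J j).1 := by
    rintro n ⟨_, c, S, hc, hS, rfl⟩
    obtain ⟨J, hJ⟩ := (𝒮.separation _ (ω n).1.2 _ (ω n).r_pos (ω n).2.2.1.2).image 𝒮.τ_pos.le
      (ω n).r_pos.le 𝒮.isCompact hc hS
    refine ⟨fun j => ⟨J j, ?_⟩, hJ⟩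
    obtain ⟨-, G, hG, hGJ⟩ := hJ.copy j
    refine ⟨(ω n).r * c, G ∘ S, mul_pos (ω n).r_pos hc, fun x y => ?_, ?_⟩
    · rw [Function.comp_apply, Function.comp_apply, hG, hS, mul_assoc]
    · rw [hGJ, image_comp]
  choose J hJ using step
  let cell : (n : ℕ) → Word ω n → {I : Set (EuclideanSpace ℝ (Fin D)) // Q I} := fun n =>
    Nat.rec (motive := fun n => Word ω n → {I : Set (EuclideanSpace ℝ (Fin D)) // Q I})
      (fun _ => ⟨𝒮.I₀, 1, id, one_pos, fun x y => by simp, by simp⟩)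
      (fun n f w => J n (f (Fin.init (α := fun i : Fin (n + 1) => Fin (ω i).T) w))
        (w (Fin.last n))) n
  refine ⟨⟨fun n v => (cell n v).1, fun _ => rfl, fun n v => ?_⟩⟩
  convert hJ n (cell n v) using 2 with j
  change (J n (cell n (Fin.init (α := fun i : Fin (n + 1) => Fin (ω i).T) (v.child j)))
    ((v.child j) (Fin.last n))).1 = _
  have h1 : Fin.init (α := fun i : Fin (n + 1) => Fin (ω i).T) (v.child j) = v :=
    Fin.init_snoc (α := fun i : Fin (n + 1) => Fin (ω i).T) j v
  have h2 : (v.child j) (Fin.last n) = j :=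
    Fin.snoc_last (α := fun i : Fin (n + 1) => Fin (ω i).T) j v
  rw [h1, h2]

end Moran

end

open Moran

namespace Moran

/-! The argument separates chance from geometry. The only random input is that, almost surely, sums
of `X`, `Y`, `Z` over windows `[n, n + k)` are within `ε * k` of `k` times their means once `k ≥ K
log n` and `n` is large (`ae_hasWindowMean`). Exponential moments give a Chernoff bound `q ^ k` with
`q < 1`, which at that length is summable over all pairs `(n, k)`, so Borel–Cantelli applies.
Everything after that holds for each single sample with this property and for every choice of Moran
sets, which is why one `Γ` serves all `Φ` and all constructions.

Separation makes balls comparable with cells: `R` and `r` locate steps `a` and `b`, the ratio of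
ball measures is the exponential of a sum of `-log p` over roughly `[a, b)`, and `R / r` is the
exponential of the sum of `Z` there. Each `-log p` lies between `X` and `Y`. Largeness of `Φ` says
exactly that `b - a` exceeds every multiple of `log a` (`IsLarge.exists_window`), so the window
means give `upperDim_le` and `le_lowerDim`.

The opposite bounds `le_upperDim` and `lowerDim_le` are attained at the point whose address always
takes the lightest, respectively heaviest, child. There the window may start at a fixed step and
grow without limit, so any dimension function will do. -/

/-- The sums of `a` over windows `[n, n + k)` have mean close to `c` as soon as `k` is at least a
constant multiple of `log n`. -/
def HasWindowMean (a : ℕ → ℝ) (c : ℝ) : Prop :=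
  ∀ ε : ℝ, 0 < ε → ∃ K : ℝ, 0 ≤ K ∧ ∃ N : ℕ, ∀ n ≥ N, ∀ k : ℕ, K * Real.log (n + 1) ≤ k →
    |∑ i ∈ Finset.range k, a (n + i) - k * c| ≤ ε * k

/-! ### Large deviations for windows of an iid sequence. -/

section Probability

open ProbabilityTheory

variable {α : Type*} [MeasurableSpace α] {π : Measure α} {W : α → ℝ}

lemma HasExpMoments.zero_mem_interior (h : HasExpMoments π W) :
    (0 : ℝ) ∈ interior (integrableExpSet W π) := by
  obtain ⟨A, hA, hint⟩ := h
  rw [mem_interior_iff_mem_nhds]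
  filter_upwards [Metric.closedBall_mem_nhds (0 : ℝ) hA] with s hs
  exact hint s (by simpa using hs)

lemma HasExpMoments.neg (h : HasExpMoments π W) : HasExpMoments π (fun x => -W x) := by
  obtain ⟨A, hA, hint⟩ := h
  refine ⟨A, hA, fun s hs => ?_⟩
  simpa using hint (-s) (by simpa using hs)

variable [IsProbabilityMeasure π]

/-- A bound `c` above the mean is beaten by the exponential rate. -/
lemma HasExpMoments.exists_mgf_lt (h : HasExpMoments π W) {c : ℝ} (hc : ∫ x, W x ∂π < c) :
    ∃ s : ℝ, 0 < s ∧ Integrable (fun x => Real.exp (s * W x)) π ∧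
      Real.exp (-s * c) * mgf W π s < 1 := by
  have h0 := h.zero_mem_interior
  -- The function equals `1` at `s = 0` and has slope `𝔼 W - c < 0` there, so it drops below `1` for
  -- small `s > 0`.
  have hd : HasDerivAt (fun s => Real.exp (-s * c) * mgf W π s) (∫ x, W x ∂π - c) 0 := by
    have h1 := hasDerivAt_mgf h0
    have h2 : HasDerivAt (fun s : ℝ => Real.exp (-s * c)) (-c) 0 := by
      have := (((hasDerivAt_id (0 : ℝ)).neg).mul_const c).exp
      simpa using this
    have h3 := h2.mul h1
    simp only [neg_zero, zero_mul, Real.exp_zero, mul_one, one_mul, mgf_zero] at h3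
    rw [sub_eq_neg_add]
    exact h3
  have hev : ∀ᶠ s in 𝓝[>] (0 : ℝ), Real.exp (-s * c) * mgf W π s < 1 := by
    have hslope := hd.tendsto_slope
    have h4 : ∀ᶠ s in 𝓝[≠] (0 : ℝ), slope (fun s => Real.exp (-s * c) * mgf W π s) 0 s < 0 :=
      hslope.eventually_lt_const (by linarith)
    have h5 := h4.filter_mono (nhdsWithin_mono 0 (fun x (hx : x ∈ Ioi (0 : ℝ)) => (ne_of_gt hx)))
    filter_upwards [h5, self_mem_nhdsWithin] with s hs hs0
    have hs0' : 0 < s := hs0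
    rw [slope_def_field] at hs
    simp only [neg_zero, zero_mul, Real.exp_zero, mgf_zero, mul_one, sub_zero] at hs
    have := (div_lt_iff₀ hs0').1 hs
    linarith
  have hint : ∀ᶠ s in 𝓝[>] (0 : ℝ), s ∈ integrableExpSet W π :=
    nhdsWithin_le_nhds (mem_interior_iff_mem_nhds.1 h0)
  obtain ⟨s, ⟨hs1, hs2⟩, hs3⟩ := ((hev.and hint).and self_mem_nhdsWithin).exists
  exact ⟨s, hs3, hs2, hs1⟩

/-- Chernoff bound for a window of an iid sequence. -/
lemma measure_window_le (hW : Measurable W) {s c : ℝ} (hs : 0 < s)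
    (hint : Integrable (fun x => Real.exp (s * W x)) π) (n k : ℕ) :
    (Measure.infinitePi fun _ : ℕ => π).real
      {ω | k * c ≤ ∑ i ∈ Finset.range k, W (ω (n + i))} ≤ (Real.exp (-s * c) * mgf W π s) ^ k := by
  set P := Measure.infinitePi fun _ : ℕ => π
  have hind : iIndepFun (fun (i : ℕ) (ω : ℕ → α) => W (ω (n + i))) P :=
    (iIndepFun_infinitePi (P := fun _ : ℕ => π) (X := fun _ => W) fun _ => hW).precomp
      (g := fun i => n + i) (add_right_injective n)
  have hmeas : ∀ i : ℕ, Measurable fun ω : ℕ → α => W (ω (n + i)) := fun i =>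
    hW.comp (measurable_pi_apply _)
  have hmp : ∀ i : ℕ, MeasurePreserving (Function.eval i) P π := fun i =>
    measurePreserving_eval_infinitePi (fun _ : ℕ => π) i
  have hI : ∀ i : ℕ, Integrable (fun ω : ℕ → α => Real.exp (s * W (ω (n + i)))) P := fun i =>
    (hmp (n + i)).integrable_comp_of_integrable hint
  have hmgf : ∀ i : ℕ, mgf (fun ω : ℕ → α => W (ω (n + i))) P s = mgf W π s := fun i => by
    have hm : AEStronglyMeasurable (fun x => Real.exp (s * W x))
        (P.map (Function.eval (n + i))) := by
      rw [(hmp (n + i)).map_eq]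
      exact hint.1
    have := integral_map (hmp (n + i)).measurable.aemeasurable hm
    rw [(hmp (n + i)).map_eq] at this
    exact this.symm
  have hsum := hind.mgf_sum (t := s) hmeas (Finset.range k)
  have h1 := measure_ge_le_exp_mul_mgf (μ := P)
    (X := ∑ i ∈ Finset.range k, fun ω : ℕ → α => W (ω (n + i))) (k * c) hs.le
    (hind.integrable_exp_mul_sum hmeas fun i _ => hI i)
  rw [hsum, Finset.prod_congr rfl fun i _ => hmgf i, Finset.prod_const, Finset.card_range] at h1
  simp only [Finset.sum_apply] at h1
  refine h1.trans (le_of_eq ?_)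
  rw [mul_pow, ← Real.exp_nat_mul]
  ring_nf

/-- Borel–Cantelli over the pairs `(n, k)` at once: only finitely many long windows are bad, hence
none starts beyond some step. -/
lemma ae_window_lt (hW : Measurable W) (h : HasExpMoments π W) {c : ℝ} (hc : ∫ x, W x ∂π < c) :
    ∀ᵐ ω ∂(Measure.infinitePi fun _ : ℕ => π), ∃ K : ℝ, 0 ≤ K ∧ ∃ N : ℕ, ∀ n ≥ N, ∀ k : ℕ,
      K * Real.log (n + 1) ≤ k → ∑ i ∈ Finset.range k, W (ω (n + i)) < k * c := by
  obtain ⟨s, hs, hint, hlt⟩ := h.exists_mgf_lt hc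
  set P := Measure.infinitePi fun _ : ℕ => π
  set q := Real.exp (-s * c) * mgf W π s
  have hq : 0 < q := mul_pos (Real.exp_pos _) (mgf_pos hint)
  have hl : 0 < -Real.log q := neg_pos.2 (Real.log_neg hq hlt)
  set l := -Real.log q with hl_def
  set K := 4 / l
  let E : ℕ × ℕ → Set (ℕ → α) := fun nk => {ω | K * Real.log (nk.1 + 1) ≤ nk.2 ∧
    nk.2 * c ≤ ∑ i ∈ Finset.range nk.2, W (ω (nk.1 + i))}
  have hE : ∀ nk, P (E nk) ≤
      ENNReal.ofReal (((nk.1 : ℝ) + 1) ^ (-2 : ℝ) * Real.exp (-(l / 2)) ^ nk.2) := by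
    rintro ⟨n, k⟩
    by_cases hK : K * Real.log (n + 1) ≤ k
    · rw [← ofReal_measureReal]
      refine ENNReal.ofReal_le_ofReal ?_
      calc P.real (E (n, k)) ≤ q ^ k :=
            (measureReal_mono fun ω hω => hω.2).trans (measure_window_le hW hs hint n k)
        _ = Real.exp (-l * k) := by
            rw [hl_def, neg_neg, mul_comm, Real.exp_nat_mul, Real.exp_log hq]
        _ ≤ Real.exp (-2 * Real.log (n + 1) + k * (-(l / 2))) := by
            refine Real.exp_le_exp.2 ?_
            have h1 : 4 * Real.log (n + 1) ≤ l * k := by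
              have := mul_le_mul_of_nonneg_left hK hl.le
              have h2 : l * (K * Real.log (n + 1)) = 4 * Real.log (n + 1) := by
                simp only [K]; field_simp
              linarith
            linarith
        _ = _ := by
            rw [Real.exp_add, Real.exp_nat_mul, Real.rpow_def_of_pos (by positivity)]
            ring_nf
    · have : E (n, k) = ∅ := by
        ext ω
        simp [E, hK]
      rw [this]
      simp
  have hsummable : Summable fun nk : ℕ × ℕ =>
      (((nk.1 : ℝ) + 1) ^ (-2 : ℝ) * Real.exp (-(l / 2)) ^ nk.2) := by
    refine Summable.mul_of_nonneg (f := fun n : ℕ => ((n : ℝ) + 1) ^ (-2 : ℝ))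
      (g := fun k : ℕ => Real.exp (-(l / 2)) ^ k) ?_ ?_ (fun n => by positivity)
      (fun k => by positivity)
    · have := (summable_nat_add_iff 1).2 (Real.summable_nat_rpow.2 (by norm_num : (-2 : ℝ) < -1))
      simpa using this
    · exact summable_geometric_of_lt_one (by positivity) (by rw [Real.exp_lt_one_iff]; linarith)
  have hfin : ∑' nk, P (E nk) ≠ ⊤ :=
    ne_top_of_le_ne_top hsummable.tsum_ofReal_ne_top (ENNReal.tsum_le_tsum hE)
  filter_upwards [ae_finite_setOfPred_mem hfin] with ω hω
  obtain ⟨N, hN⟩ := (hω.image Prod.fst).bddAbove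
  refine ⟨K, by positivity, N + 1, fun n hn k hk => ?_⟩
  by_contra! hcon
  have : n ≤ N := hN ⟨(n, k), ⟨hk, hcon⟩, rfl⟩
  omega

theorem ae_hasWindowMean (hW : Measurable W) (h : HasExpMoments π W) :
    ∀ᵐ ω ∂(Measure.infinitePi fun _ : ℕ => π), HasWindowMean (fun i => W (ω i)) (∫ x, W x ∂π) := by
  -- The exceptional set depends on the margin, so the margins are restricted to the countable
  -- family `1 / (j + 1)`.
  have hpos : ∀ j : ℕ, (0 : ℝ) < 1 / (j + 1) := fun j => by positivity
  have h1 := ae_all_iff.2 fun j : ℕ =>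
    ae_window_lt hW h (c := ∫ x, W x ∂π + 1 / (j + 1)) (by linarith [hpos j])
  have h2 := ae_all_iff.2 fun j : ℕ =>
    ae_window_lt (W := fun x => -W x) hW.neg h.neg (c := -∫ x, W x ∂π + 1 / (j + 1))
      (by rw [integral_neg]; linarith [hpos j])
  filter_upwards [h1, h2] with ω hω1 hω2 ε hε
  obtain ⟨j, hj⟩ := exists_nat_one_div_lt (half_pos hε)
  obtain ⟨K₁, hK₁, N₁, hN₁⟩ := hω1 j
  obtain ⟨K₂, hK₂, N₂, hN₂⟩ := hω2 j
  refine ⟨max K₁ K₂, hK₁.trans (le_max_left _ _), max N₁ N₂, fun n hn k hk => ?_⟩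
  have hlog : 0 ≤ Real.log ((n : ℝ) + 1) := Real.log_nonneg (by linarith [n.cast_nonneg (α := ℝ)])
  have hu := hN₁ n ((le_max_left _ _).trans hn) k
    ((mul_le_mul_of_nonneg_right (le_max_left _ _) hlog).trans hk)
  have hl := hN₂ n ((le_max_right _ _).trans hn) k
    ((mul_le_mul_of_nonneg_right (le_max_right _ _) hlog).trans hk)
  rw [Finset.sum_neg_distrib] at hl
  have hjk : (k : ℝ) * (1 / (j + 1)) ≤ k * (ε / 2) := by gcongr
  have hk0 : (0 : ℝ) ≤ k * ε := by positivity
  rw [abs_le]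
  constructor <;> linarith

end Probability

variable {D : ℕ} {𝒮 : Setting D}

/-! ### Measurability of `X`, `Y`, `Z`. -/

section Measurability

lemma Param.measurable_of_comp_mk {β : Type*} [MeasurableSpace β] {f : Param 𝒮 → β}
    (h : ∀ t, Measurable fun x => f ⟨t, x⟩) : Measurable f := by
  intro s hs
  rw [Sigma.instMeasurableSpace, MeasurableSpace.measurableSet_iInf]
  exact fun t => h t hs

lemma Param.measurable_X : Measurable (Param.X : Param 𝒮 → ℝ) :=
  measurable_of_comp_mk fun t => by
    have h : ∀ j : Fin (t : ℕ), Measurable fun x : {x : ℝ × (Fin (t : ℕ) → ℝ) //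
        (0 < x.1 ∧ x.1 ≤ 𝒮.ρ t) ∧ (∀ i, 0 < x.2 i) ∧ ∑ i, x.2 i = 1} => x.1.2 j := fun j =>
      (measurable_pi_apply j).comp (measurable_snd.comp measurable_subtype_coe)
    exact (Real.measurable_log.comp (Measurable.iSup h)).neg

lemma Param.measurable_Y : Measurable (Param.Y : Param 𝒮 → ℝ) :=
  measurable_of_comp_mk fun t => by
    have h : ∀ j : Fin (t : ℕ), Measurable fun x : {x : ℝ × (Fin (t : ℕ) → ℝ) //
        (0 < x.1 ∧ x.1 ≤ 𝒮.ρ t) ∧ (∀ i, 0 < x.2 i) ∧ ∑ i, x.2 i = 1} => x.1.2 j := fun j =>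
      (measurable_pi_apply j).comp (measurable_snd.comp measurable_subtype_coe)
    exact (Real.measurable_log.comp (Measurable.iInf h)).neg

lemma Param.measurable_Z : Measurable (Param.Z : Param 𝒮 → ℝ) :=
  measurable_of_comp_mk fun _ =>
    (Real.measurable_log.comp (measurable_fst.comp measurable_subtype_coe)).neg

end Measurability

/-! ### Transfer between `π` and the sample law. -/

section SampleLaw

variable {π : Measure (Param 𝒮)} [IsProbabilityMeasure π]

instance : IsProbabilityMeasure (sampleLaw π) :=
  inferInstanceAs (IsProbabilityMeasure (Measure.infinitePi fun _ : ℕ => π))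

lemma integral_sampleLaw {W : Param 𝒮 → ℝ} (hW : Measurable W) :
    ∫ ω, W (ω 0) ∂sampleLaw π = ∫ x, W x ∂π := by
  have hmp : MeasurePreserving (Function.eval 0) (sampleLaw π) π :=
    measurePreserving_eval_infinitePi (fun _ : ℕ => π) 0
  have h := integral_map hmp.measurable.aemeasurable
    (hW.aestronglyMeasurable (μ := (sampleLaw π).map (Function.eval 0)))
  rw [hmp.map_eq] at h
  exact h.symm

lemma HasExpMoments.of_sampleLaw {W : Param 𝒮 → ℝ} (hW : Measurable W)
    (h : HasExpMoments (sampleLaw π) fun ω => W (ω 0)) : HasExpMoments π W := by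
  have hmp : MeasurePreserving (Function.eval 0) (sampleLaw π) π :=
    measurePreserving_eval_infinitePi (fun _ : ℕ => π) 0
  obtain ⟨A, hA, hint⟩ := h
  refine ⟨A, hA, fun s hs => ?_⟩
  have hm : Measurable fun x => Real.exp (s * W x) := (hW.const_mul s).exp
  exact (hmp.integrable_comp hm.aestronglyMeasurable).1 (hint s hs)

/-- The windows of an iid sequence with exponential moments have a mean for almost all samples, and
the exceptional set may be chosen measurable. -/
lemma exists_measurableSet_hasWindowMean {W : Param 𝒮 → ℝ} (hW : Measurable W) :
    ∃ Γ : Set (Sample 𝒮), MeasurableSet Γ ∧ sampleLaw π Γ = 1 ∧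
      (HasExpMoments (sampleLaw π) (fun ω => W (ω 0)) →
        ∀ ω ∈ Γ, HasWindowMean (fun i => W (ω i)) (∫ ω, W (ω 0) ∂sampleLaw π)) := by
  by_cases h : HasExpMoments (sampleLaw π) (fun ω => W (ω 0))
  · have hae := ae_hasWindowMean hW (h.of_sampleLaw hW)
    obtain ⟨t, hst, ht, ht0⟩ := exists_measurable_superset_of_null (ae_iff.1 hae)
    refine ⟨tᶜ, ht.compl, (prob_compl_eq_one_iff ht).2 ht0, fun _ ω hω => ?_⟩
    rw [integral_sampleLaw hW]
    by_contra hcon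
    exact hω (hst hcon)
  -- Without exponential moments nothing is claimed. This case lets the set be chosen before the
  -- moment hypothesis is known.
  · exact ⟨univ, MeasurableSet.univ, measure_univ, fun h' => absurd h' h⟩

end SampleLaw

/-! ### Diameters of the Moran sets. -/

section Scale

/-- The diameter of the Moran sets of step `n`. -/
noncomputable def scale (ω : Sample 𝒮) (n : ℕ) : ℝ := ∏ i ∈ Finset.range n, (ω i).r

variable (ω : Sample 𝒮)

lemma scale_zero : scale ω 0 = 1 := by simp [scale]

lemma scale_pos (n : ℕ) : 0 < scale ω n := Finset.prod_pos fun i _ => (ω i).r_pos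

lemma scale_succ (n : ℕ) : scale ω (n + 1) = scale ω n * (ω n).r := Finset.prod_range_succ _ _

lemma scale_succ_lt (n : ℕ) : scale ω (n + 1) < scale ω n := by
  rw [scale_succ]
  nlinarith [scale_pos ω n, (ω n).r_le]

lemma scale_strictAnti : StrictAnti (scale ω) := strictAnti_nat_of_succ_lt (scale_succ_lt ω)

lemma scale_le_half_pow (n : ℕ) : scale ω n ≤ (1 / 2) ^ n := by
  calc scale ω n ≤ ∏ _i ∈ Finset.range n, (1 / 2 : ℝ) :=
        Finset.prod_le_prod (fun i _ => (ω i).r_pos.le) fun i _ => (ω i).r_le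
    _ = (1 / 2) ^ n := by simp

lemma tendsto_scale : Tendsto (scale ω) atTop (𝓝 0) :=
  squeeze_zero (fun n => (scale_pos ω n).le) (scale_le_half_pow ω)
    (tendsto_pow_atTop_nhds_zero_of_lt_one (by norm_num) (by norm_num))

lemma scale_div_scale (n k : ℕ) :
    scale ω n / scale ω (n + k) = Real.exp (∑ i ∈ Finset.range k, (ω (n + i)).Z) := by
  rw [div_eq_iff (scale_pos ω _).ne', scale, scale, Finset.prod_range_add, Real.exp_sum,
    mul_left_comm, ← Finset.prod_mul_distrib, Finset.prod_eq_one (s := Finset.range k), mul_one]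
  intro i _
  rw [Param.Z, Real.exp_neg, Real.exp_log (ω (n + i)).r_pos,
    inv_mul_cancel₀ (ω (n + i)).r_pos.ne']

lemma exists_scale_lt_le {s : ℝ} (hs : 0 < s) (hs1 : s ≤ 1) :
    ∃ n, scale ω (n + 1) < s ∧ s ≤ scale ω n := by
  classical
  have hex : ∃ n, scale ω n < s := ((tendsto_scale ω).eventually_lt_const hs).exists
  have hne : Nat.find hex ≠ 0 := fun h => by
    have := Nat.find_spec hex
    rw [h, scale_zero] at this
    linarith
  obtain ⟨n, hn⟩ := Nat.exists_eq_succ_of_ne_zero hne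
  refine ⟨n, ?_, ?_⟩
  · have := Nat.find_spec hex
    rwa [hn] at this
  · exact not_lt.1 (Nat.find_min hex (by omega))

end Scale

/-! ### Comparison of balls with cells. -/

namespace Construction

variable {ω : Sample 𝒮} (C : Construction ω)

/-- The separation gained at the step where two addresses part persists, since the scales decrease.
-/
lemma le_dist_of_ne : ∀ (n : ℕ) {v w : Word ω n}, v ≠ w →
    ∀ x ∈ C.cell n v, ∀ y ∈ C.cell n w, 𝒮.τ * scale ω n ≤ dist x y
  | 0, v, w => fun h => absurd (Subsingleton.elim v w) h
  | n + 1, v', w' => fun hne x hx y hy => by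
    obtain ⟨v, i, rfl⟩ := v'.exists_child
    obtain ⟨w, j, rfl⟩ := w'.exists_child
    by_cases hvw : v = w
    · subst hvw
      have h := (C.children n v).separated i j (fun h => hne (by rw [h])) x hx y hy
      rw [C.diam_cell] at h
      rw [scale_succ, scale]
      linarith
    · exact (mul_le_mul_of_nonneg_left (scale_succ_lt ω n).le 𝒮.τ_pos.le).trans
        (le_dist_of_ne n hvw x (C.cell_child_subset v i hx) y (C.cell_child_subset w j hy))

lemma measure_cell_le_ball {n : ℕ} {v : Word ω n} {x : EuclideanSpace ℝ (Fin D)}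
    (hx : x ∈ C.cell n v) {R : ℝ} (hR : scale ω n < R) :
    C.measure.real (C.cell n v) ≤ C.measure.real (Metric.ball x R) := by
  refine measureReal_mono fun y hy => ?_
  refine lt_of_le_of_lt (Metric.dist_le_diam_of_mem (C.isCompact_cell n v).isBounded hy hx) ?_
  rwa [C.diam_cell]

lemma measure_ball_le_cell {n : ℕ} {v : Word ω n} {x : EuclideanSpace ℝ (Fin D)}
    (hx : x ∈ C.cell n v) {R : ℝ} (hR : R ≤ 𝒮.τ * scale ω n) :
    C.measure.real (Metric.ball x R) ≤ C.measure.real (C.cell n v) := by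
  rw [measureReal_def, measureReal_def]
  refine ENNReal.toReal_mono (measure_ne_top _ _) ?_
  -- The ball need not lie inside the cell. The comparison is made on addresses, so that only coded
  -- points matter, and those in other cells are too far from `x`.
  rw [measure, Measure.map_apply C.measurable_point Metric.isOpen_ball.measurableSet,
    Measure.map_apply C.measurable_point (C.isCompact_cell n v).measurableSet]
  refine measure_mono fun y hy => ?_
  by_cases h : y.trunc n = v
  · exact h ▸ C.point_mem y n
  · have h1 := C.le_dist_of_ne n h _ (C.point_mem y n) _ hx
    have h2 : dist (C.point y) x < R := hy
    linarith

lemma measureReal_cell_trunc (y : Code ω) (n : ℕ) :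
    C.measure.real (C.cell n (y.trunc n)) = ∏ i ∈ Finset.range n, (ω i).p (y i) := by
  rw [measureReal_def, C.measure_cell, ENNReal.toReal_prod, Finset.prod_range]
  exact Finset.prod_congr rfl fun i _ => ENNReal.toReal_ofReal ((ω i).p_pos _).le

lemma measureReal_cell_pos (y : Code ω) (n : ℕ) :
    0 < C.measure.real (C.cell n (y.trunc n)) := by
  rw [C.measureReal_cell_trunc]
  exact Finset.prod_pos fun i _ => (ω i).p_pos _

lemma measureReal_cell_div (y : Code ω) (n k : ℕ) :
    C.measure.real (C.cell n (y.trunc n)) / C.measure.real (C.cell (n + k) (y.trunc (n + k))) =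
      Real.exp (∑ i ∈ Finset.range k, -Real.log ((ω (n + i)).p (y (n + i)))) := by
  rw [div_eq_iff (C.measureReal_cell_pos y _).ne', C.measureReal_cell_trunc,
    C.measureReal_cell_trunc, Finset.prod_range_add, Real.exp_sum,
    mul_left_comm, ← Finset.prod_mul_distrib, Finset.prod_eq_one (s := Finset.range k), mul_one]
  intro i _
  rw [Real.exp_neg, Real.exp_log ((ω (n + i)).p_pos _), inv_mul_cancel₀ ((ω (n + i)).p_pos _).ne']

variable {C} in
lemma measureReal_ball_pos {x : EuclideanSpace ℝ (Fin D)} {y : Code ω}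
    (hx : ∀ n, x ∈ C.cell n (y.trunc n)) {R : ℝ} (hR : 0 < R) :
    0 < C.measure.real (Metric.ball x R) := by
  obtain ⟨n, hn⟩ := ((tendsto_scale ω).eventually_lt_const hR).exists
  exact (C.measureReal_cell_pos y n).trans_le (C.measure_cell_le_ball (hx n) hn)

variable {C} in
lemma measureReal_ball_div_le {x : EuclideanSpace ℝ (Fin D)} {y : Code ω}
    (hx : ∀ n, x ∈ C.cell n (y.trunc n)) {n k : ℕ} {r R : ℝ} (hR : R ≤ 𝒮.τ * scale ω n)
    (hr : scale ω (n + k) < r) :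
    C.measure.real (Metric.ball x R) / C.measure.real (Metric.ball x r) ≤
      Real.exp (∑ i ∈ Finset.range k, -Real.log ((ω (n + i)).p (y (n + i)))) := by
  rw [← C.measureReal_cell_div]
  exact div_le_div₀ measureReal_nonneg (C.measure_ball_le_cell (hx n) hR)
    (C.measureReal_cell_pos y _) (C.measure_cell_le_ball (hx _) hr)

variable {C} in
lemma le_measureReal_ball_div {x : EuclideanSpace ℝ (Fin D)} {y : Code ω}
    (hx : ∀ n, x ∈ C.cell n (y.trunc n)) {n k : ℕ} {r R : ℝ} (hR : scale ω n < R) (hr0 : 0 < r)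
    (hr : r ≤ 𝒮.τ * scale ω (n + k)) :
    Real.exp (∑ i ∈ Finset.range k, -Real.log ((ω (n + i)).p (y (n + i)))) ≤
      C.measure.real (Metric.ball x R) / C.measure.real (Metric.ball x r) := by
  rw [← C.measureReal_cell_div]
  exact div_le_div₀ measureReal_nonneg (C.measure_cell_le_ball (hx n) hR)
    (measureReal_ball_pos hx hr0) (C.measure_ball_le_cell (hx _) hr)

lemma point_mem_support (y : Code ω) : C.point y ∈ C.measure.support := by
  rw [Measure.mem_support_iff_forall]
  intro U hU
  obtain ⟨R, hR, hRU⟩ := Metric.mem_nhds_iff.1 hU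
  have h := measureReal_ball_pos (C.point_mem y) hR
  rw [measureReal_def, ENNReal.toReal_pos_iff] at h
  exact h.1.trans_le (measure_mono hRU)

/-- At each step the finite union of cells is closed and carries the full measure, so it contains
the support. Disjointness of the cells makes the words found at successive steps extend one another.
-/
lemma exists_code_of_mem_support {x : EuclideanSpace ℝ (Fin D)} (hx : x ∈ C.measure.support) :
    ∃ y : Code ω, ∀ n, x ∈ C.cell n (y.trunc n) := by
  have hex : ∀ n, ∃ v : Word ω n, x ∈ C.cell n v := fun n => by
    have hcl : IsClosed (⋃ v : Word ω n, C.cell n v) :=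
      isClosed_iUnion_of_finite fun v => (C.isCompact_cell n v).isClosed
    refine mem_iUnion.1 (Measure.support_subset_of_isClosed hcl ?_ hx)
    rw [measure, mem_ae_map_iff C.measurable_point.aemeasurable hcl.measurableSet]
    exact univ_mem' fun y => mem_iUnion.2 ⟨_, C.point_mem y n⟩
  choose v hv using hex
  refine ⟨fun n => v (n + 1) (Fin.last n), fun n => ?_⟩
  suffices h : Code.trunc (fun n => v (n + 1) (Fin.last n)) n = v n from h ▸ hv n
  induction n with
  | zero => exact Subsingleton.elim _ _
  | succ n ih =>
    rw [Code.trunc_succ, ih]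
    obtain ⟨w, j, hw⟩ := (v (n + 1)).exists_child
    have hwx : x ∈ C.cell n w := C.cell_child_subset w j (hw ▸ hv (n + 1))
    have hwv : w = v n := by
      by_contra hne
      exact Set.disjoint_left.1 (C.disjoint_cell n _ _ hne) hwx (hv n)
    have hj : v (n + 1) (Fin.last n) = j := by
      rw [hw]
      exact Fin.snoc_last (α := fun i : Fin (n + 1) => Fin (ω i).T) j w
    change (v n).child (v (n + 1) (Fin.last n)) = _
    rw [hj, hw, hwv]

end Construction

/-! ### Bounds on the logarithmic weights. -/

namespace Param

variable (a : Param 𝒮)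

lemma nonempty_label : Nonempty (Fin a.T) := ⟨⟨0, lt_of_lt_of_le two_pos a.1.2⟩⟩

lemma X_le (j : Fin a.T) : a.X ≤ -Real.log (a.p j) :=
  neg_le_neg (Real.log_le_log (a.p_pos j) (le_ciSup (Set.finite_range _).bddAbove j))

lemma exists_eq_X : ∃ j : Fin a.T, -Real.log (a.p j) = a.X := by
  have := a.nonempty_label
  obtain ⟨j, hj⟩ := exists_eq_ciSup_of_finite (f := a.p)
  exact ⟨j, by rw [X, hj]⟩

lemma exists_eq_Y : ∃ j : Fin a.T, -Real.log (a.p j) = a.Y := by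
  have := a.nonempty_label
  obtain ⟨j, hj⟩ := exists_eq_ciInf_of_finite (f := a.p)
  exact ⟨j, by rw [Y, hj]⟩

lemma le_Y (j : Fin a.T) : -Real.log (a.p j) ≤ a.Y := by
  have := a.nonempty_label
  obtain ⟨i, hi⟩ := exists_eq_ciInf_of_finite (f := a.p)
  refine neg_le_neg (Real.log_le_log (hi ▸ a.p_pos i) (ciInf_le (Set.finite_range _).bddBelow j))

lemma p_le_one (j : Fin a.T) : a.p j ≤ 1 :=
  a.sum_p ▸ Finset.single_le_sum (fun i _ => (a.p_pos i).le) (Finset.mem_univ j)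

lemma X_nonneg : 0 ≤ a.X := by
  obtain ⟨j, hj⟩ := a.exists_eq_X
  rw [← hj]
  exact neg_nonneg.2 (Real.log_nonpos (a.p_pos j).le (a.p_le_one j))

/-- The least of at least two weights with sum `1` is at most `1 / 2`. -/
lemma log_two_le_Y : Real.log 2 ≤ a.Y := by
  have h : (a.T : ℝ) * (⨅ j, a.p j) ≤ 1 := by
    rw [← a.sum_p]
    have := Finset.card_nsmul_le_sum Finset.univ a.p (⨅ j, a.p j)
      fun j _ => ciInf_le (Set.finite_range _).bddBelow j
    simpa using this
  have hT : (2 : ℝ) ≤ a.T := by exact_mod_cast a.1.2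
  have := a.nonempty_label
  obtain ⟨i, hi⟩ := exists_eq_ciInf_of_finite (f := a.p)
  have hpos : 0 < ⨅ j, a.p j := hi ▸ a.p_pos i
  rw [Y, ← Real.log_inv]
  refine Real.log_le_log two_pos ((le_inv_comm₀ two_pos hpos).2 ?_)
  nlinarith

lemma log_two_le_Z : Real.log 2 ≤ a.Z := by
  rw [Z, ← Real.log_inv]
  exact Real.log_le_log two_pos ((le_inv_comm₀ two_pos a.r_pos).2 (by simpa using a.r_le))

end Param

/-! ### Window means and the effect of largeness. -/

section WindowMean

variable {a : ℕ → ℝ} {c : ℝ}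

lemma HasWindowMean.eventually (h : HasWindowMean a c) {ε : ℝ} (hε : 0 < ε) :
    ∀ᶠ n : ℕ in atTop, ∀ᶠ k : ℕ in atTop, |∑ i ∈ Finset.range k, a (n + i) - k * c| ≤ ε * k := by
  obtain ⟨K, -, N, hN⟩ := h ε hε
  filter_upwards [eventually_ge_atTop N] with n hn
  filter_upwards [tendsto_natCast_atTop_atTop.eventually_ge_atTop (K * Real.log (n + 1))] with k hk
  exact hN n hn k hk

lemma HasWindowMean.le_of_forall_le (h : HasWindowMean a c) {b : ℝ} (hb : ∀ i, b ≤ a i) :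
    b ≤ c := by
  refine le_of_forall_pos_le_add fun ε hε => ?_
  obtain ⟨n, hn⟩ := (h.eventually hε).exists
  obtain ⟨k, hk, hk1⟩ := (hn.and (eventually_ge_atTop 1)).exists
  have hsum := Finset.card_nsmul_le_sum (Finset.range k) (fun i => a (n + i)) b fun i _ => hb _
  rw [Finset.card_range, nsmul_eq_mul] at hsum
  have hk0 : (0 : ℝ) < k := by exact_mod_cast hk1
  have := (abs_le.1 hk).2
  nlinarith

end WindowMean

lemma eventually_lt_exp_mul {η : ℝ} (hη : 0 < η) (c : ℝ) :
    ∀ᶠ k : ℕ in atTop, c < Real.exp (η * k) :=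
  (Real.tendsto_exp_atTop.comp
    (tendsto_natCast_atTop_atTop.const_mul_atTop hη)).eventually_gt_atTop c

/-- Used with `n` the step of `R`: there `|log R| ≥ n / 2`, so this turns `log |log R|` into the
logarithm of the step. -/
lemma log_add_two_le {n : ℕ} (hn : 4 ≤ n) :
    Real.log (n + 2) ≤ 4 * Real.log (n / 2) := by
  have hn' : (4 : ℝ) ≤ n := by exact_mod_cast hn
  rw [show (4 : ℝ) = ((4 : ℕ) : ℝ) by norm_num, ← Real.log_pow]
  refine Real.log_le_log (by positivity) ?_
  have h1 : (2 : ℝ) ≤ n / 2 := by linarith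
  have h2 : (2 : ℝ) ^ 3 ≤ (n / 2) ^ 3 := by gcongr
  calc (n : ℝ) + 2 ≤ 2 ^ 3 * (n / 2) := by linarith
    _ ≤ (n / 2) ^ 3 * (n / 2) := by gcongr
    _ = (n / 2) ^ 4 := by ring

/-- If `Φ` is large then, at small scales, the annuli admitted in the definition of the
`Φ`-dimensions cross many steps of the construction. -/
lemma IsLarge.exists_window {Φ : ℝ → ℝ} (hΦ : IsLarge Φ) {ω : Sample 𝒮} {c : ℝ}
    (hz : HasWindowMean (fun i => (ω i).Z) c) {K : ℝ} (hK : 0 ≤ K) (N : ℕ) :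
    ∃ δ : ℝ, 0 < δ ∧ δ < 1 ∧ ∀ r R : ℝ, 0 < r → 0 < R → R ≤ δ → r < R ^ (1 + Φ R) →
      ∀ a b : ℕ, 𝒮.τ * scale ω (a + 1) < R → R ≤ scale ω a → 𝒮.τ * scale ω (b + 1) < r →
        ∃ k : ℕ, b = a + 1 + k ∧ N ≤ a ∧ K * Real.log (a + 2) ≤ k := by
  have hτ := 𝒮.τ_pos
  have hlogτ : 0 ≤ -Real.log 𝒮.τ := neg_nonneg.2 (Real.log_nonpos hτ.le 𝒮.τ_lt_one.le)
  have hc : 0 < c := (Real.log_pos one_lt_two).trans_le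
    (hz.le_of_forall_le fun i => (ω i).log_two_le_Z)
  obtain ⟨-, A, δ₀, hδ₀, hA, hAtop⟩ := hΦ
  obtain ⟨K₁, hK₁, N₁, hN₁⟩ := hz 1 one_pos
  set K' := max K K₁
  -- Chosen so that crossing at most `⌈K' L⌉ + 2` steps, at a cost of at most `c + 1` each, keeps
  -- `log (R / r)` below `M * L`; the `3` absorbs the ceiling and the two boundary steps, as `L ≥
  -- 1`.
  set M := -Real.log 𝒮.τ + (c + 1) * (3 + K')
  have hK' : 0 ≤ K' := hK.trans (le_max_left _ _)
  have hM : 0 ≤ M := by positivity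
  obtain ⟨δ₁, hδ₁, hAM⟩ := mem_nhdsGT_iff_exists_Ioo_subset.1
    (hAtop.eventually_ge_atTop (4 * M))
  set N' := max (max N N₁) 4
  -- Below this radius, `τ * scale ω (a + 1) < R` forces `a > N'`.
  set δ₂ := 𝒮.τ * scale ω (N' + 1)
  have hδ₂ : 0 < δ₂ := mul_pos hτ (scale_pos ω _)
  have hδ₁' : 0 < δ₁ := hδ₁
  have h0 : 0 < min (min δ₀ δ₁) (min δ₂ 1) := by positivity
  refine ⟨min (min δ₀ δ₁) (min δ₂ 1) / 2, half_pos h0, ?_, ?_⟩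
  · have : min (min δ₀ δ₁) (min δ₂ 1) ≤ 1 := (min_le_right _ _).trans (min_le_right _ _)
    linarith
  intro r R hr hR hRδ hrR a b haR hRa hbr
  have hRm : R < min (min δ₀ δ₁) (min δ₂ 1) := by linarith
  have hR0 : R < δ₀ := hRm.trans_le ((min_le_left _ _).trans (min_le_left _ _))
  have hR1 : R < δ₁ := hRm.trans_le ((min_le_left _ _).trans (min_le_right _ _))
  have hR2 : R < δ₂ := hRm.trans_le ((min_le_right _ _).trans (min_le_left _ _))
  have hR3 : R < 1 := hRm.trans_le ((min_le_right _ _).trans (min_le_right _ _))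
  have haN : N' < a := by
    have h1 : scale ω (a + 1) < scale ω (N' + 1) :=
      lt_of_mul_lt_mul_left (haR.trans hR2) hτ.le
    have := (scale_strictAnti ω).lt_iff_gt.1 h1
    omega
  have haN0 : N ≤ a := ((le_max_left _ _).trans (le_max_left _ _)).trans haN.le
  have haN1 : N₁ ≤ a := ((le_max_right _ _).trans (le_max_left _ _)).trans haN.le
  have ha4 : 4 ≤ a := (le_max_right _ _).trans haN.le
  have ha4' : (4 : ℝ) ≤ a := by exact_mod_cast ha4
  set L := Real.log ((a : ℝ) + 2)
  have hL : 1 ≤ L := by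
    rw [Real.le_log_iff_exp_le (by positivity)]
    linarith [Real.exp_one_lt_d9]
  have hlower : M * L < Real.log R - Real.log r := by
    have hlogR : Real.log R < 0 := Real.log_neg hR hR3
    have habs : |Real.log R| = -Real.log R := abs_of_neg hlogR
    have h1 : Real.log r < (1 + Φ R) * Real.log R := by
      rw [← Real.log_rpow hR]
      exact Real.log_lt_log hr hrR
    have h2 := hA R ⟨hR, hR3⟩ hR0
    have h3 : A R * Real.log |Real.log R| ≤ Φ R * |Real.log R| := by
      have := mul_le_mul_of_nonneg_right h2 (abs_nonneg (Real.log R))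
      rwa [mul_assoc, div_mul_cancel₀ _ (abs_pos.2 hlogR.ne).ne'] at this
    have h4 : 4 * M ≤ A R := hAM ⟨hR, hR1⟩
    have h5 : (a : ℝ) / 2 ≤ |Real.log R| := by
      have h6 : Real.log R ≤ a * Real.log (1 / 2) := by
        rw [← Real.log_pow]
        exact Real.log_le_log hR (hRa.trans (scale_le_half_pow ω a))
      rw [one_div, Real.log_inv] at h6
      rw [habs]
      nlinarith [Real.log_two_gt_d9]
    have h7 : L ≤ 4 * Real.log |Real.log R| :=
      (log_add_two_le ha4).trans
        (mul_le_mul_of_nonneg_left (Real.log_le_log (by positivity) h5) (by norm_num))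
    have h8 : M * L ≤ A R * Real.log |Real.log R| := by
      calc M * L ≤ M * (4 * Real.log |Real.log R|) := by gcongr
        _ = 4 * M * Real.log |Real.log R| := by ring
        _ ≤ A R * Real.log |Real.log R| := by
          gcongr
          linarith
    rw [habs] at h3 h8
    linarith
  -- If too few steps were crossed, the window mean of `Z` would bound `log (R / r)` by `M * L`,
  -- against `hlower`.
  by_contra hcon
  set k' := ⌈K' * L⌉₊ with hk'
  have hb : b + 1 ≤ a + (k' + 2) := by
    by_contra! hlt
    refine hcon ⟨b - (a + 1), by omega, haN0, ?_⟩
    have h1 : (k' : ℝ) ≤ (b - (a + 1) : ℕ) := by exact_mod_cast (by omega)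
    calc K * L ≤ K' * L := by gcongr; exact le_max_left _ _
      _ ≤ k' := Nat.le_ceil _
      _ ≤ _ := h1
  have hk'le : (k' : ℝ) < K' * L + 1 := Nat.ceil_lt_add_one (by positivity)
  have hsum : ∑ i ∈ Finset.range (k' + 2), (ω (a + i)).Z ≤ (c + 1) * (k' + 2) := by
    have h1 : K₁ * Real.log ((a : ℝ) + 1) ≤ (k' + 2 : ℕ) := by
      push_cast
      calc K₁ * Real.log ((a : ℝ) + 1) ≤ K' * L := 
            mul_le_mul (le_max_right _ _) (Real.log_le_log (by positivity) (by linarith))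
              (Real.log_nonneg (by linarith)) hK'
        _ ≤ k' := Nat.le_ceil _
        _ ≤ k' + 2 := by linarith
    have h2 := (abs_le.1 (hN₁ a haN1 (k' + 2) h1)).2
    push_cast at h2
    linarith
  have hupper : Real.log R - Real.log r ≤ -Real.log 𝒮.τ + (c + 1) * (k' + 2) := by
    have h1 : 𝒮.τ * scale ω (a + (k' + 2)) ≤ r :=
      (mul_le_mul_of_nonneg_left ((scale_strictAnti ω).antitone hb) hτ.le).trans hbr.le
    have h2 := Real.log_le_log (mul_pos hτ (scale_pos ω _)) h1
    rw [Real.log_mul hτ.ne' (scale_pos ω _).ne'] at h2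
    have h3 := Real.log_le_log hR hRa
    have h4 : Real.log (scale ω a) - Real.log (scale ω (a + (k' + 2))) =
        ∑ i ∈ Finset.range (k' + 2), (ω (a + i)).Z := by
      rw [← Real.log_div (scale_pos ω _).ne' (scale_pos ω _).ne', scale_div_scale, Real.log_exp]
    linarith
  have hfin : -Real.log 𝒮.τ + (c + 1) * (k' + 2) ≤ M * L := by
    have h1 : (c + 1) * (k' + 2) ≤ (c + 1) * ((3 + K') * L) := by
      gcongr
      linarith
    have h2 : -Real.log 𝒮.τ ≤ -Real.log 𝒮.τ * L := le_mul_of_one_le_right hlogτ hL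
    calc _ ≤ -Real.log 𝒮.τ * L + (c + 1) * ((3 + K') * L) := add_le_add h2 h1
      _ = M * L := by ring
  linarith

lemma IsDimensionFunction.rpow_le {Φ : ℝ → ℝ} (hΦ : IsDimensionFunction Φ) {R : ℝ} (hR : 0 < R)
    (hR1 : R < 1) : R ^ (1 + Φ R) ≤ R := by
  have h := Real.rpow_le_rpow_of_exponent_ge hR hR1.le
    (show (1 : ℝ) ≤ 1 + Φ R by linarith [hΦ.nonneg R ⟨hR, hR1⟩])
  rwa [Real.rpow_one] at h

/-! ### The four dimension bounds. -/

namespace Construction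

variable {ω : Sample 𝒮} (C : Construction ω) {Φ : ℝ → ℝ} {c e : ℝ}

theorem upperDim_le (hΦ : IsLarge Φ) (hy : HasWindowMean (fun i => (ω i).Y) e)
    (hz : HasWindowMean (fun i => (ω i).Z) c) : upperDim Φ C.measure ≤ ((e / c : ℝ) : EReal) := by
  have hlog2 := Real.log_pos one_lt_two
  have hc : 0 < c := hlog2.trans_le (hz.le_of_forall_le fun i => (ω i).log_two_le_Z)
  have he : 0 < e := hlog2.trans_le (hy.le_of_forall_le fun i => (ω i).log_two_le_Y)
  have hτ := 𝒮.τ_pos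
  rw [← EReal.le_of_forall_lt_iff_le]
  intro d hd
  rw [EReal.coe_lt_coe_iff] at hd
  have hd0 : 0 < d := (div_pos he hc).trans hd
  rw [div_lt_iff₀ hc] at hd
  -- The solution of `e + ε = d * (c - ε)`, so that the two exponential rates agree exactly.
  set ε := (d * c - e) / (1 + d) with hε_def
  have hε : 0 < ε := div_pos (by linarith) (by linarith)
  have hεd : e + ε = d * (c - ε) := by
    rw [hε_def]; field_simp; ring
  obtain ⟨K₁, hK₁, N₁, hN₁⟩ := hy ε hε
  obtain ⟨K₂, hK₂, N₂, hN₂⟩ := hz ε hε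
  obtain ⟨δ, hδ, hδ1, hwin⟩ := hΦ.exists_window hz (hK₁.trans (le_max_left K₁ K₂)) (max N₁ N₂)
  -- The measure ratio is bounded over `k + 2` steps and `R / r` over the inner `k`: the two extra
  -- steps cost `exp (2 * (e + ε))` and separation costs `τ ^ d`. The bound `R ≤ τ` allows a step to
  -- be found for `R / τ`.
  refine sInf_le ⟨d, ⟨min δ 𝒮.τ, Real.exp (2 * (e + ε)) / 𝒮.τ ^ d, lt_min hδ hτ,
    (min_le_left _ _).trans_lt hδ1, by positivity, ?_⟩, rfl⟩
  intro r R hr hrR hRR hR x hx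
  obtain ⟨y, hxy⟩ := C.exists_code_of_mem_support hx
  have hR0 : 0 < R := hr.trans (hrR.trans_le hRR)
  have hR1 : R < 1 := (hR.trans (min_le_left _ _)).trans_lt hδ1
  obtain ⟨a, ha1, ha2⟩ := exists_scale_lt_le ω (div_pos hR0 hτ)
    ((div_le_one hτ).2 (hR.trans (min_le_right _ _)))
  obtain ⟨b, hb1, hb2⟩ := exists_scale_lt_le ω hr ((hrR.trans_le hRR).trans hR1).le
  rw [lt_div_iff₀ hτ, mul_comm] at ha1
  rw [div_le_iff₀ hτ, mul_comm] at ha2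
  obtain ⟨k, rfl, haN, hk⟩ := hwin r R hr hR0 (hR.trans (min_le_left _ _)) hrR a b ha1
    (ha2.trans (mul_le_of_le_one_left (scale_pos ω a).le 𝒮.τ_lt_one.le))
    ((mul_le_of_le_one_left (scale_pos ω _).le 𝒮.τ_lt_one.le).trans_lt hb1)
  have hlog : 0 ≤ Real.log ((a : ℝ) + 2) :=
    Real.log_nonneg (by linarith [a.cast_nonneg (α := ℝ)])
  have hY : ∑ i ∈ Finset.range (k + 2), (ω (a + i)).Y ≤ (e + ε) * (k + 2) := by
    have h1 : K₁ * Real.log ((a : ℝ) + 1) ≤ (k + 2 : ℕ) := by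
      push_cast
      calc K₁ * Real.log ((a : ℝ) + 1) ≤ max K₁ K₂ * Real.log ((a : ℝ) + 2) := by
            have : Real.log ((a : ℝ) + 1) ≤ Real.log ((a : ℝ) + 2) :=
              Real.log_le_log (by positivity) (by linarith)
            exact (mul_le_mul_of_nonneg_left this hK₁).trans
              (mul_le_mul_of_nonneg_right (le_max_left _ _) hlog)
        _ ≤ k + 2 := by linarith
    have h2 := (abs_le.1 (hN₁ a ((le_max_left _ _).trans haN) (k + 2) h1)).2
    push_cast at h2
    linarith
  have hZ : (c - ε) * k ≤ ∑ i ∈ Finset.range k, (ω (a + 1 + i)).Z := by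
    have h1 : K₂ * Real.log (((a + 1 : ℕ) : ℝ) + 1) ≤ k := by
      push_cast
      rw [add_assoc, one_add_one_eq_two]
      exact (mul_le_mul_of_nonneg_right (le_max_right _ _) hlog).trans hk
    have h2 := (abs_le.1
      (hN₂ (a + 1) (((le_max_right _ _).trans haN).trans (Nat.le_succ a)) k h1)).1
    linarith
  have hratio : C.measure.real (Metric.ball x R) / C.measure.real (Metric.ball x r) ≤
      Real.exp ((e + ε) * (k + 2)) := by
    refine (measureReal_ball_div_le hxy (n := a) (k := k + 2) ha2 ?_).trans
      (Real.exp_le_exp.2 ((Finset.sum_le_sum fun i _ => (ω (a + i)).le_Y _).trans hY))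
    convert hb1 using 2
    ring
  have hRr : 𝒮.τ * Real.exp ((c - ε) * k) ≤ R / r := by
    calc 𝒮.τ * Real.exp ((c - ε) * k)
        ≤ 𝒮.τ * (scale ω (a + 1) / scale ω (a + 1 + k)) := by
          rw [scale_div_scale]
          gcongr
      _ = 𝒮.τ * scale ω (a + 1) / scale ω (a + 1 + k) := (mul_div_assoc _ _ _).symm
      _ ≤ R / r := div_le_div₀ hR0.le ha1.le hr hb2
  calc _ ≤ Real.exp ((e + ε) * (k + 2)) := hratio
    _ = Real.exp (2 * (e + ε)) / 𝒮.τ ^ d * (𝒮.τ * Real.exp ((c - ε) * k)) ^ d := by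
      rw [Real.mul_rpow hτ.le (Real.exp_pos _).le, ← Real.exp_mul, ← mul_assoc,
        div_mul_cancel₀ _ (Real.rpow_pos_of_pos hτ d).ne', ← Real.exp_add]
      congr 1
      rw [show (c - ε) * k * d = d * (c - ε) * k by ring, ← hεd]
      ring
    _ ≤ _ := by gcongr

theorem le_lowerDim (hΦ : IsLarge Φ) (hx : HasWindowMean (fun i => (ω i).X) e)
    (hz : HasWindowMean (fun i => (ω i).Z) c) : ((e / c : ℝ) : EReal) ≤ lowerDim Φ C.measure := by
  have hlog2 := Real.log_pos one_lt_two
  have hc : 0 < c := hlog2.trans_le (hz.le_of_forall_le fun i => (ω i).log_two_le_Z)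
  have hτ := 𝒮.τ_pos
  rw [← EReal.ge_of_forall_gt_iff_ge]
  intro d hd
  rw [EReal.coe_lt_coe_iff] at hd
  -- For `d ≤ 0` monotonicity of the measure suffices; `d > 0` is needed below to divide by `1 + d`
  -- and to raise bounds to the power `d`.
  rcases le_or_gt d 0 with hd0 | hd0
  · refine le_sSup ⟨d, ⟨1 / 2, 1, by norm_num, by norm_num, one_pos, ?_⟩, rfl⟩
    intro r R hr hrR hRR hR x hx
    obtain ⟨y, hxy⟩ := C.exists_code_of_mem_support hx
    have hrR' : r ≤ R := hrR.le.trans hRR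
    calc 1 * (R / r) ^ d ≤ 1 := by
          rw [one_mul]
          exact Real.rpow_le_one_of_one_le_of_nonpos ((one_le_div hr).2 hrR') hd0
      _ ≤ _ := (one_le_div (measureReal_ball_pos hxy hr)).2
          (measureReal_mono (Metric.ball_subset_ball hrR'))
  rw [lt_div_iff₀ hc] at hd
  set ε := (e - d * c) / (1 + d) with hε_def
  have hε : 0 < ε := div_pos (by linarith) (by linarith)
  have hεd : e - ε = d * (c + ε) := by
    rw [hε_def]; field_simp; ring
  obtain ⟨K₁, hK₁, N₁, hN₁⟩ := hx ε hε
  obtain ⟨K₂, hK₂, N₂, hN₂⟩ := hz ε hε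
  obtain ⟨δ, hδ, hδ1, hwin⟩ := hΦ.exists_window hz (hK₁.trans (le_max_left K₁ K₂)) (max N₁ N₂)
  refine le_sSup ⟨d, ⟨min δ 𝒮.τ, 𝒮.τ ^ d * Real.exp (-(2 * (e - ε))), lt_min hδ hτ,
    (min_le_left _ _).trans_lt hδ1, by positivity, ?_⟩, rfl⟩
  intro r R hr hrR hRR hR x hx
  obtain ⟨y, hxy⟩ := C.exists_code_of_mem_support hx
  have hR0 : 0 < R := hr.trans (hrR.trans_le hRR)
  have hR1 : R < 1 := (hR.trans (min_le_left _ _)).trans_lt hδ1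
  have hrτ : r ≤ 𝒮.τ := (hrR.le.trans hRR).trans (hR.trans (min_le_right _ _))
  -- Compared with `upperDim_le` the factor `τ` moves from `R` to `r`: now the large ball must
  -- contain a cell and the small one must charge at most a cell.
  obtain ⟨a, ha1, ha2⟩ := exists_scale_lt_le ω hR0 hR1.le
  obtain ⟨b, hb1, hb2⟩ := exists_scale_lt_le ω (div_pos hr hτ) ((div_le_one hτ).2 hrτ)
  rw [lt_div_iff₀ hτ, mul_comm] at hb1
  rw [div_le_iff₀ hτ, mul_comm] at hb2
  obtain ⟨k, rfl, haN, hk⟩ := hwin r R hr hR0 (hR.trans (min_le_left _ _)) hrR a b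
    ((mul_le_of_le_one_left (scale_pos ω _).le 𝒮.τ_lt_one.le).trans_lt ha1) ha2 hb1
  have hlog : 0 ≤ Real.log ((a : ℝ) + 2) :=
    Real.log_nonneg (by linarith [a.cast_nonneg (α := ℝ)])
  have hZ : ∑ i ∈ Finset.range (k + 2), (ω (a + i)).Z ≤ (c + ε) * (k + 2) := by
    have h1 : K₂ * Real.log ((a : ℝ) + 1) ≤ (k + 2 : ℕ) := by
      push_cast
      calc K₂ * Real.log ((a : ℝ) + 1) ≤ max K₁ K₂ * Real.log ((a : ℝ) + 2) := by
            have : Real.log ((a : ℝ) + 1) ≤ Real.log ((a : ℝ) + 2) :=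
              Real.log_le_log (by positivity) (by linarith)
            exact (mul_le_mul_of_nonneg_left this hK₂).trans
              (mul_le_mul_of_nonneg_right (le_max_right _ _) hlog)
        _ ≤ k + 2 := by linarith
    have h2 := (abs_le.1 (hN₂ a ((le_max_right _ _).trans haN) (k + 2) h1)).2
    push_cast at h2
    linarith
  have hX : (e - ε) * k ≤ ∑ i ∈ Finset.range k, (ω (a + 1 + i)).X := by
    have h1 : K₁ * Real.log (((a + 1 : ℕ) : ℝ) + 1) ≤ k := by
      push_cast
      rw [add_assoc, one_add_one_eq_two]
      exact (mul_le_mul_of_nonneg_right (le_max_left _ _) hlog).trans hk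
    have h2 := (abs_le.1 (hN₁ (a + 1) (((le_max_left _ _).trans haN).trans (Nat.le_succ a)) k h1)).1
    linarith
  have hratio : Real.exp ((e - ε) * k) ≤
      C.measure.real (Metric.ball x R) / C.measure.real (Metric.ball x r) :=
    (Real.exp_le_exp.2 (hX.trans (Finset.sum_le_sum fun i _ => (ω (a + 1 + i)).X_le _))).trans
      (le_measureReal_ball_div hxy ha1 hr hb2)
  have hRr : R / r ≤ 𝒮.τ⁻¹ * Real.exp ((c + ε) * (k + 2)) := by
    calc R / r ≤ scale ω a / (𝒮.τ * scale ω (a + (k + 2))) := by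
          refine div_le_div₀ (scale_pos ω a).le ha2 (mul_pos hτ (scale_pos ω _)) ?_
          convert hb1.le using 3
          ring
      _ = 𝒮.τ⁻¹ * (scale ω a / scale ω (a + (k + 2))) := by
          field_simp
      _ ≤ 𝒮.τ⁻¹ * Real.exp ((c + ε) * (k + 2)) := by
          rw [scale_div_scale]
          gcongr
  calc 𝒮.τ ^ d * Real.exp (-(2 * (e - ε))) * (R / r) ^ d
      ≤ 𝒮.τ ^ d * Real.exp (-(2 * (e - ε))) * (𝒮.τ⁻¹ * Real.exp ((c + ε) * (k + 2))) ^ d := by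
        gcongr
    _ = Real.exp ((e - ε) * k) := by
      rw [Real.mul_rpow (by positivity) (Real.exp_pos _).le, ← Real.exp_mul,
        Real.inv_rpow hτ.le,
        show (c + ε) * (k + 2) * d = d * (c + ε) * (k + 2) by ring, ← hεd]
      have hne := (Real.rpow_pos_of_pos hτ d).ne'
      calc _ = Real.exp (-(2 * (e - ε))) * Real.exp ((e - ε) * (k + 2)) := by field_simp
        _ = _ := by rw [← Real.exp_add]; ring_nf
    _ ≤ _ := hratio

theorem le_upperDim (hΦ : IsDimensionFunction Φ) (hy : HasWindowMean (fun i => (ω i).Y) e)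
    (hz : HasWindowMean (fun i => (ω i).Z) c) : ((e / c : ℝ) : EReal) ≤ upperDim Φ C.measure := by
  have hlog2 := Real.log_pos one_lt_two
  have hc : 0 < c := hlog2.trans_le (hz.le_of_forall_le fun i => (ω i).log_two_le_Z)
  have he : 0 < e := hlog2.trans_le (hy.le_of_forall_le fun i => (ω i).log_two_le_Y)
  have hτ := 𝒮.τ_pos
  refine le_sInf ?_
  rintro _ ⟨d, ⟨C₁, C₂, hC₁, hC₁1, hC₂, hd⟩, rfl⟩
  refine EReal.coe_le_coe_iff.2 ?_
  by_contra! hlt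
  -- An admissible `d` might be negative; since `R / r ≥ 1`, it may be raised to `d'`.
  set d' := max d 0
  have hd' : 0 ≤ d' := le_max_right _ _
  have hlt' : d' < e / c := max_lt hlt (div_pos he hc)
  rw [lt_div_iff₀ hc] at hlt'
  -- Half of the available gap: the surplus rate `ε * (1 + d')` remains and, as `k` grows, beats the
  -- fixed constant `C₂ * (2 / τ) ^ d'`.
  set ε := (e - d' * c) / (2 * (1 + d')) with hε_def
  have hε : 0 < ε := div_pos (by linarith) (by linarith)
  have hεd : e - ε = ε * (1 + d') + d' * (c + ε) := by
    rw [hε_def]; field_simp; ring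
  choose j hj using fun i => (ω i).exists_eq_Y
  obtain ⟨n, ⟨hn1, hn2⟩, hn3⟩ := (((hy.eventually hε).and (hz.eventually hε)).and
    ((tendsto_scale ω).eventually_le_const (half_pos hC₁))).exists
  -- The factor `2` gives the strict inequality `scale ω n < R` that an open ball needs to contain
  -- the cell.
  set R := 2 * scale ω n with hR_def
  have hR0 : 0 < R := mul_pos two_pos (scale_pos ω n)
  have hR : R ≤ C₁ := by linarith
  have hlim : Tendsto (fun k => 𝒮.τ * scale ω (n + k)) atTop (𝓝 0) := by
    have := ((tendsto_scale ω).comp (tendsto_add_atTop_nat n)).const_mul 𝒮.τ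
    simpa [Function.comp_def, add_comm] using this
  obtain ⟨k, ⟨⟨hk1, hk2⟩, hk3⟩, hk4⟩ := (((hn1.and hn2).and
    (hlim.eventually_lt_const (Real.rpow_pos_of_pos hR0 (1 + Φ R)))).and
    (eventually_lt_exp_mul (mul_pos hε (by linarith : 0 < 1 + d')) (C₂ * (2 / 𝒮.τ) ^ d'))).exists
  set r := 𝒮.τ * scale ω (n + k)
  have hr : 0 < r := mul_pos hτ (scale_pos ω _)
  have hRR := hΦ.rpow_le hR0 (hR.trans_lt hC₁1)
  have h1 := hd r R hr hk3 hRR hR (C.point j) (C.point_mem_support j)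
  have h2 := le_measureReal_ball_div (C.point_mem j) (n := n) (k := k) (R := R)
    (by linarith [scale_pos ω n]) hr le_rfl
  simp only [hj] at h2
  have hRr1 : 1 ≤ R / r := (one_le_div hr).2 (hk3.le.trans hRR)
  have hRr : R / r ≤ 2 / 𝒮.τ * Real.exp ((c + ε) * k) := by
    calc R / r = 2 / 𝒮.τ * (scale ω n / scale ω (n + k)) := mul_div_mul_comm _ _ _ _
      _ ≤ _ := by
        rw [scale_div_scale]
        gcongr
        linarith [(abs_le.1 hk2).2]
  have h3 : Real.exp ((e - ε) * k) ≤
      C₂ * (2 / 𝒮.τ) ^ d' * Real.exp (d' * (c + ε) * k) := by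
    calc Real.exp ((e - ε) * k) ≤ Real.exp (∑ i ∈ Finset.range k, (ω (n + i)).Y) :=
          Real.exp_le_exp.2 (by linarith [(abs_le.1 hk1).1])
      _ ≤ C₂ * (R / r) ^ d := h2.trans h1
      _ ≤ C₂ * (R / r) ^ d' := by
          gcongr
          exact le_max_left _ _
      _ ≤ C₂ * (2 / 𝒮.τ * Real.exp ((c + ε) * k)) ^ d' := by gcongr
      _ = _ := by
          rw [Real.mul_rpow (by positivity) (Real.exp_pos _).le, ← Real.exp_mul]
          ring_nf
  rw [hεd, add_mul, Real.exp_add] at h3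
  exact absurd (le_of_mul_le_mul_right h3 (Real.exp_pos _)) (not_le.2 hk4)

theorem lowerDim_le (hΦ : IsDimensionFunction Φ) (hx : HasWindowMean (fun i => (ω i).X) e)
    (hz : HasWindowMean (fun i => (ω i).Z) c) : lowerDim Φ C.measure ≤ ((e / c : ℝ) : EReal) := by
  have hlog2 := Real.log_pos one_lt_two
  have hc : 0 < c := hlog2.trans_le (hz.le_of_forall_le fun i => (ω i).log_two_le_Z)
  have he : 0 ≤ e := hx.le_of_forall_le fun i => (ω i).X_nonneg
  have hτ := 𝒮.τ_pos
  refine sSup_le ?_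
  rintro _ ⟨d, ⟨C₁, C₂, hC₁, hC₁1, hC₂, hd⟩, rfl⟩
  refine EReal.coe_le_coe_iff.2 ?_
  by_contra! hlt
  have hd0 : 0 < d := (div_nonneg he hc.le).trans_lt hlt
  rw [div_lt_iff₀ hc] at hlt
  set ε := (d * c - e) / (2 * (1 + d)) with hε_def
  have hε : 0 < ε := div_pos (by linarith) (by linarith)
  have hεd : d * (c - ε) = ε * (1 + d) + (e + ε) := by
    rw [hε_def]; field_simp; ring
  -- Along the heaviest children the measure decays at the slowest possible rate, with every `-log
  -- p` equal to `X`.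
  choose j hj using fun i => (ω i).exists_eq_X
  obtain ⟨n, ⟨hn1, hn2⟩, hn3⟩ := (((hx.eventually hε).and (hz.eventually hε)).and
    ((tendsto_scale ω).eventually_le_const hC₁)).exists
  set R := 𝒮.τ * scale ω n with hR_def
  have hR0 : 0 < R := mul_pos hτ (scale_pos ω n)
  have hR : R ≤ C₁ :=
    (mul_le_of_le_one_left (scale_pos ω n).le 𝒮.τ_lt_one.le).trans hn3
  have hlim : Tendsto (fun k => 2 * scale ω (n + k)) atTop (𝓝 0) := by
    have := ((tendsto_scale ω).comp (tendsto_add_atTop_nat n)).const_mul 2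
    simpa [Function.comp_def, add_comm] using this
  obtain ⟨k, ⟨⟨hk1, hk2⟩, hk3⟩, hk4⟩ := (((hn1.and hn2).and
    (hlim.eventually_lt_const (Real.rpow_pos_of_pos hR0 (1 + Φ R)))).and
    (eventually_lt_exp_mul (mul_pos hε (by linarith : 0 < 1 + d)) (C₂ * (𝒮.τ / 2) ^ d)⁻¹)).exists
  set r := 2 * scale ω (n + k)
  have hr : 0 < r := mul_pos two_pos (scale_pos ω _)
  have hRR := hΦ.rpow_le hR0 (hR.trans_lt hC₁1)
  have h1 := hd r R hr hk3 hRR hR (C.point j) (C.point_mem_support j)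
  have h2 := measureReal_ball_div_le (C.point_mem j) (n := n) (k := k) (R := R) (r := r) le_rfl
    (by linarith [scale_pos ω (n + k)])
  simp only [hj] at h2
  have hRr : 𝒮.τ / 2 * Real.exp ((c - ε) * k) ≤ R / r := by
    calc _ ≤ 𝒮.τ / 2 * (scale ω n / scale ω (n + k)) := by
          rw [scale_div_scale]
          gcongr
          linarith [(abs_le.1 hk2).1]
      _ = R / r := (mul_div_mul_comm _ _ _ _).symm
  have h3 : C₂ * (𝒮.τ / 2) ^ d * Real.exp (d * (c - ε) * k) ≤ Real.exp ((e + ε) * k) := by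
    calc _ = C₂ * (𝒮.τ / 2 * Real.exp ((c - ε) * k)) ^ d := by
          rw [Real.mul_rpow (by positivity) (Real.exp_pos _).le, ← Real.exp_mul]
          ring_nf
      _ ≤ C₂ * (R / r) ^ d := by gcongr
      _ ≤ Real.exp (∑ i ∈ Finset.range k, (ω (n + i)).X) := h1.trans h2
      _ ≤ _ := Real.exp_le_exp.2 (by linarith [(abs_le.1 hk1).2])
  rw [hεd, add_mul, Real.exp_add, ← mul_assoc] at h3
  have h4 := (mul_le_iff_le_one_left (Real.exp_pos _)).1 h3
  rw [inv_lt_iff_one_lt_mul₀ (by positivity)] at hk4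
  linarith

end Construction

end Moran

/-! ### Assembly on a common set of full probability. -/

theorem mainTheorem1 {D : ℕ} (𝒮 : Setting D) (π : Measure (Param 𝒮)) [IsProbabilityMeasure π]
    (hZ : HasExpMoments (sampleLaw π) (fun ω : Sample 𝒮 => (ω 0).Z)) :
    ∃ Γ : Set (Sample 𝒮), MeasurableSet Γ ∧ sampleLaw π Γ = 1 ∧
      (HasExpMoments (sampleLaw π) (fun ω : Sample 𝒮 => (ω 0).X) →
        ∀ Φ : ℝ → ℝ, IsLarge Φ → ∀ ω ∈ Γ, ∀ C : Construction ω,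
          lowerDim Φ C.measure =
            (((∫ ω, (ω 0).X ∂sampleLaw π) / (∫ ω, (ω 0).Z ∂sampleLaw π) : ℝ) : EReal)) ∧
      (HasExpMoments (sampleLaw π) (fun ω : Sample 𝒮 => (ω 0).Y) →
        ∀ Φ : ℝ → ℝ, IsLarge Φ → ∀ ω ∈ Γ, ∀ C : Construction ω,
          upperDim Φ C.measure =
            (((∫ ω, (ω 0).Y ∂sampleLaw π) / (∫ ω, (ω 0).Z ∂sampleLaw π) : ℝ) : EReal)) := by
  obtain ⟨Γ₁, hm₁, hp₁, h₁⟩ := exists_measurableSet_hasWindowMean (π := π) Param.measurable_X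
  obtain ⟨Γ₂, hm₂, hp₂, h₂⟩ := exists_measurableSet_hasWindowMean (π := π) Param.measurable_Y
  obtain ⟨Γ₃, hm₃, hp₃, h₃⟩ := exists_measurableSet_hasWindowMean (π := π) Param.measurable_Z
  refine ⟨Γ₁ ∩ Γ₂ ∩ Γ₃, (hm₁.inter hm₂).inter hm₃, ?_, fun hX Φ hΦ ω hω C => ?_,
    fun hY Φ hΦ ω hω C => ?_⟩
  · rw [← mem_ae_iff_prob_eq_one ((hm₁.inter hm₂).inter hm₃)]
    exact inter_mem (inter_mem ((mem_ae_iff_prob_eq_one hm₁).2 hp₁)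
      ((mem_ae_iff_prob_eq_one hm₂).2 hp₂)) ((mem_ae_iff_prob_eq_one hm₃).2 hp₃)
  · exact le_antisymm (C.lowerDim_le hΦ.1 (h₁ hX ω hω.1.1) (h₃ hZ ω hω.2))
      (C.le_lowerDim hΦ (h₁ hX ω hω.1.1) (h₃ hZ ω hω.2))
  · exact le_antisymm (C.upperDim_le hΦ (h₂ hY ω hω.1.2) (h₃ hZ ω hω.2))
      (C.le_upperDim hΦ.1 (h₂ hY ω hω.1.2) (h₃ hZ ω hω.2))
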